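/- **Theorem (fifth order tempered quasi-compact approximation).** Let $1<\alpha<2$ with $862-\alpha-285\alpha^2-15\alpha^3+15\alpha^4\neq 0$, let $\lambda\ge 0$, and let $u\in C^8(\mathbb R)$ be real-valued such that $u$ and all its derivatives up to order $8$ belong to $L^1(\mathbb R)$. Let $$D^{\alpha,\lambda}u(x)=\frac{e^{-\lambda x}}{\Gamma(2-\alpha)}\frac{d^2}{dx^2}\int_{-\infty}^x (x-s)^{1-\alpha}e^{\lambda s}u(s)\,ds$$ be the left Riemann–Liouville tempered fractional derivative, and for $p\in\mathbb Z$, $h>0$ let $$\Delta_p^{\alpha,\lambda}u(x)=\frac1{h^\alpha}\sum_{k=0}^\infty g_k^{(\alpha)}e^{-(k-p)\lambda h}u(x-(k-p)h),\qquad g_k^{(\alpha)}=\frac{\Gamma(k-\alpha)}{\Gamma(-\alpha)\Gamma(k+1)},$$ be the left shifted tempered Grünwald–Letnikov operator. Put $d=862-\alpha-285\alpha^2-15\alpha^3+15\alpha^4$ and $$m=\frac{350+331\alpha-15\alpha^2-75\alpha^3-15\alpha^4}{2d},\qquad n=\frac{566-329\alpha-135\alpha^2+105\alpha^3-15\alpha^4}{2d},$$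 $$\mu_1=\frac{566+329\alpha-135\alpha^2-105\alpha^3-15\alpha^4}{2d},\quad \mu_0=\frac{862+\alpha-285\alpha^2+15\alpha^3+15\alpha^4}{d},\quad \mu_{-1}=\frac{350-331\alpha-15\alpha^2+75\alpha^3-15\alpha^4}{2d}.$$ Then $D^{\alpha,\lambda}u$ is well defined on $\mathbb R$ (the integral converges absolutely for every $x$ and is a $C^2$ function of $x$), the series defining $\Delta_p^{\alpha,\lambda}u(x)$ converge absolutely for all $p\in\mathbb Z$, $h>0$, $x\in\mathbb R$, and, as $h\to0^+$, $$m e^{-\lambda h}D^{\alpha,\lambda}u(x-h)+D^{\alpha,\lambda}u(x)+n e^{\lambda h}D^{\alpha,\lambda}u(x+h)=\mu_1\Delta_1^{\alpha,\lambda}u(x)+\mu_0\Delta_0^{\alpha,\lambda}u(x)+\mu_{-1}\Delta_{-1}^{\alpha,\lambda}u(x)+O(h^5)$$ uniformly in $x\in\mathbb R$. -/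

import Mathlib

open MeasureTheory Set

noncomputable section

/-- The singular integral `∫_{-∞}^x (x - s)^{n - α - 1} f(s) ds` with `n = ⌈α⌉`, so that
`n - 1 < α < n` when `α > 0` is not an integer. -/
def leftSingularIntegral (α : ℝ) (f : ℝ → ℝ) (x : ℝ) : ℝ :=
  ∫ s in Iio x, (x - s) ^ ((⌈α⌉₊ : ℝ) - α - 1) * f s

/-- The left Riemann-Liouville fractional derivative on `(-∞, x)` of non-integer order `α > 0`:
`1 / Γ(n - α) * (d/dx)^n ∫_{-∞}^x (x - s)^{n - α - 1} f(s) ds` with `n = ⌈α⌉`. -/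
def leftRLDeriv (α : ℝ) (f : ℝ → ℝ) (x : ℝ) : ℝ :=
  1 / Real.Gamma ((⌈α⌉₊ : ℝ) - α) * iteratedDeriv ⌈α⌉₊ (leftSingularIntegral α f) x

/-- The left Riemann-Liouville tempered fractional derivative
`e^{-λ x} D^α (e^{λ x} u(x))` on `(-∞, x)`. -/
def leftTemperedDeriv (α lam : ℝ) (u : ℝ → ℝ) (x : ℝ) : ℝ :=
  Real.exp (-lam * x) * leftRLDeriv α (fun s => Real.exp (lam * s) * u s) x

/-- The Grünwald weight `g_k = Γ(k - α) / (Γ(-α) Γ(k + 1))`. -/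
def grunwaldWeight (α : ℝ) (k : ℕ) : ℝ :=
  Real.Gamma ((k : ℝ) - α) / (Real.Gamma (-α) * Real.Gamma ((k : ℝ) + 1))

/-- The `k`-th term `g_k e^{-(k - p) λ h} u(x - (k - p) h)` of the shifted tempered
Grünwald-Letnikov series. -/
def temperedGrunwaldTerm (α lam : ℝ) (p : ℤ) (h : ℝ) (u : ℝ → ℝ) (x : ℝ) (k : ℕ) : ℝ :=
  grunwaldWeight α k * Real.exp (-((k : ℝ) - p) * lam * h) * u (x - ((k : ℝ) - p) * h)

/-- The left shifted tempered Grünwald-Letnikov operator. -/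
def temperedGrunwald (α lam : ℝ) (p : ℤ) (h : ℝ) (u : ℝ → ℝ) (x : ℝ) : ℝ :=
  1 / h ^ α * ∑' k : ℕ, temperedGrunwaldTerm α lam p h u x k

/-- The common denominator of the coefficients (up to a factor `2`). -/
def coeffDen (α : ℝ) : ℝ := 862 - α - 285 * α ^ 2 - 15 * α ^ 3 + 15 * α ^ 4

/-- The coefficient of `e^{-λ h} u(x - h)`. -/
def coeffM (α : ℝ) : ℝ :=
  (350 + 331 * α - 15 * α ^ 2 - 75 * α ^ 3 - 15 * α ^ 4) / (2 * coeffDen α)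

/-- The coefficient of `e^{λ h} u(x + h)`. -/
def coeffN (α : ℝ) : ℝ :=
  (566 - 329 * α - 135 * α ^ 2 + 105 * α ^ 3 - 15 * α ^ 4) / (2 * coeffDen α)

/-- The weight of the operator with shift `p = 1`. -/
def coeffMuOne (α : ℝ) : ℝ :=
  (566 + 329 * α - 135 * α ^ 2 - 105 * α ^ 3 - 15 * α ^ 4) / (2 * coeffDen α)

/-- The weight of the operator with shift `p = 0`. -/
def coeffMuZero (α : ℝ) : ℝ :=
  (862 + α - 285 * α ^ 2 + 15 * α ^ 3 + 15 * α ^ 4) / coeffDen α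

/-- The weight of the operator with shift `p = -1`. -/
def coeffMuNegOne (α : ℝ) : ℝ :=
  (350 - 331 * α - 15 * α ^ 2 + 75 * α ^ 3 - 15 * α ^ 4) / (2 * coeffDen α)

/-- The quasi-compact operator `v ↦ m e^{-λ h} v(x - h) + v(x) + n e^{λ h} v(x + h)`. -/
def quasiCompactOp (α lam h : ℝ) (v : ℝ → ℝ) (x : ℝ) : ℝ :=
  coeffM α * Real.exp (-lam * h) * v (x - h) + v x + coeffN α * Real.exp (lam * h) * v (x + h)

end

/-!
On the Fourier side everything is multiplication by a function of `s = λ + 2πiω`, where `ω` is the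
frequency. When `û` decays fast enough, the tempered derivative has symbol `s ^ α`. The Grünwald
weights are the Taylor coefficients of `(1 - w) ^ α` and are absolutely summable, so the tempered
Grünwald operator has symbol `((1 - exp (-sh)) / h) ^ α`. The truncation error therefore has symbol
`h ^ (-α) E(sh)` with `E(z) = z ^ α Q(z) - (1 - exp (-z)) ^ α S(z)`, where `Q` and `S` are the
symbols of the two three-point stencils. The five coefficients are chosen so that `E(z) / z ^ α`
vanishes to order `5` at `0`. As `Q` and `S` are bounded on strips `0 ≤ Re z ≤ λ`, this improves to
`|E(z)| ≤ C |z| ^ (5 + α)` on the whole strip, and the error is at most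
`C h ^ 5 ∫ |s| ^ (5 + α) |û|`, which is finite when `û(ω) = O(|ω| ^ (-N))` with `N > α + 6`.
-/

section GrunwaldWeights

theorem grunwaldWeight_zero {α : ℝ} (hα : ∀ k : ℕ, α ≠ k) : grunwaldWeight α 0 = 1 := by
  have hΓ : Real.Gamma (-α) ≠ 0 := Real.Gamma_ne_zero fun m hm => hα m (neg_inj.1 hm)
  simp [grunwaldWeight, hΓ]

theorem succ_mul_grunwaldWeight_succ {α : ℝ} (k : ℕ) (hα : α ≠ k) :
    (k + 1) * grunwaldWeight α (k + 1) = (k - α) * grunwaldWeight α k := by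
  have hk : (k : ℝ) + 1 ≠ 0 := by positivity
  simp only [grunwaldWeight, Nat.cast_add, Nat.cast_one]
  rw [add_sub_right_comm, Real.Gamma_add_one (sub_ne_zero.2 hα.symm), Real.Gamma_add_one hk,
    mul_left_comm (Real.Gamma (-α)), mul_div_assoc', mul_div_mul_left _ _ hk, mul_div_assoc]

theorem grunwaldWeight_eq_choose {α : ℝ} (hα : ∀ k : ℕ, α ≠ k) (k : ℕ) :
    grunwaldWeight α k = (-1) ^ k * Ring.choose α k := by
  induction k with
  | zero => simp [grunwaldWeight_zero hα]
  | succ k ih =>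
    have hchoose : (k + 1) * Ring.choose α (k + 1) = Ring.choose α k * (α - k) := by
      simpa using Ring.choose_smul_choose α (Nat.le_add_right k 1)
    refine mul_left_cancel₀ (Nat.cast_add_one_ne_zero k : (k : ℝ) + 1 ≠ 0) ?_
    rw [succ_mul_grunwaldWeight_succ k (hα k), ih]
    linear_combination (-1) ^ k * hchoose

theorem summable_abs_grunwaldWeight {α : ℝ} (hα₀ : 0 < α) (hα : ∀ k : ℕ, α ≠ k) :
    Summable fun k => |grunwaldWeight α k| := by
  set K := ⌈α⌉₊
  have htelescope : ∀ j : ℕ, α * |grunwaldWeight α (j + K)|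
      = (j + K : ℕ) * |grunwaldWeight α (j + K)|
        - (j + 1 + K : ℕ) * |grunwaldWeight α (j + 1 + K)| := fun j => by
    have hle : α ≤ (j + K : ℕ) := (Nat.le_ceil α).trans (mod_cast Nat.le_add_left K j)
    have h := congrArg abs (succ_mul_grunwaldWeight_succ (j + K) (hα _))
    rw [abs_mul, abs_mul, abs_of_nonneg (sub_nonneg.2 hle), abs_of_nonneg (by positivity)] at h
    rw [add_right_comm, Nat.cast_succ (j + K), h]
    ring
  rw [← summable_nat_add_iff K]
  refine summable_of_sum_range_le (c := (0 + K : ℕ) * |grunwaldWeight α (0 + K)| / α)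
    (fun _ => abs_nonneg _) fun n => ?_
  rw [le_div_iff₀' hα₀, Finset.mul_sum, Finset.sum_congr rfl fun j _ => htelescope j,
    Finset.sum_range_sub' fun j => ((j + K : ℕ) : ℝ) * |grunwaldWeight α (j + K)|]
  exact sub_le_self _ (by positivity)

theorem tsum_grunwaldWeight_mul_pow_of_norm_lt_one {α : ℝ} (hα : ∀ k : ℕ, α ≠ k) {w : ℂ}
    (hw : ‖w‖ < 1) : ∑' k : ℕ, (grunwaldWeight α k : ℂ) * w ^ k = (1 - w) ^ (α : ℂ) := by
  have h := (Complex.one_add_cpow_hasFPowerSeriesOnBall_zero (a := (α : ℂ))).hasSum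
    (y := -w) (by simpa [enorm_eq_nnnorm, ← NNReal.coe_lt_coe] using hw)
  rw [zero_add, ← sub_eq_add_neg] at h
  rw [← h.tsum_eq]
  refine tsum_congr fun k => ?_
  rw [binomialSeries_apply, grunwaldWeight_eq_choose hα, List.ofFn_const, List.prod_replicate,
    neg_pow w, smul_eq_mul]
  push_cast
  ring

theorem tsum_grunwaldWeight_mul_pow {α : ℝ} (hα₀ : 0 < α) (hα : ∀ k : ℕ, α ≠ k) {w : ℂ}
    (hw : ‖w‖ ≤ 1) : ∑' k : ℕ, (grunwaldWeight α k : ℂ) * w ^ k = (1 - w) ^ (α : ℂ) := by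
  have hseries : ContinuousOn (fun w : ℂ => ∑' k : ℕ, (grunwaldWeight α k : ℂ) * w ^ k)
      (Metric.closedBall 0 1) :=
    continuousOn_tsum (fun k => by fun_prop) (summable_abs_grunwaldWeight hα₀ hα) fun k w hw => by
      rw [norm_mul, Complex.norm_real, Real.norm_eq_abs, norm_pow]
      exact mul_le_of_le_one_right (abs_nonneg _)
        (pow_le_one₀ (norm_nonneg _) (mem_closedBall_zero_iff.1 hw))
  have hpower : ContinuousOn (fun w : ℂ => (1 - w) ^ (α : ℂ)) (Metric.closedBall 0 1) :=
    fun w hw => by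
      have hre : 0 ≤ (1 - w).re := by
        simpa using (Complex.re_le_norm w).trans (mem_closedBall_zero_iff.1 hw)
      exact (ContinuousAt.comp (f := fun w : ℂ => 1 - w)
        (Complex.continuousAt_cpow_const_of_re_pos (.inl hre) (by simpa using hα₀))
        (by fun_prop)).continuousWithinAt
  refine EqOn.of_subset_closure (s := Metric.ball 0 1)
    (fun w hw => tsum_grunwaldWeight_mul_pow_of_norm_lt_one hα (mem_ball_zero_iff.1 hw))
    hseries hpower Metric.ball_subset_closedBall ?_ (mem_closedBall_zero_iff.2 hw)
  rw [closure_ball _ one_ne_zero]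

end GrunwaldWeights

section TaylorExpansions

open Asymptotics Filter Topology
open Polynomial (eval)

/-- `f z = p₀ + p₁ z + ⋯ + pₙ₋₁ z ^ (n - 1) + O(z ^ n)` as `z → 0`. The punctured neighbourhood
leaves out the value at `0`, which is junk for functions such as `(1 - exp (-z)) / z`. -/
def HasTaylorExpansion (n : ℕ) (f : ℂ → ℂ) (p : PowerSeries ℂ) : Prop :=
  (fun z => f z - eval z (p.trunc n)) =O[𝓝[≠] 0] fun z => z ^ n

theorem isBigO_eval_one (p : Polynomial ℂ) : (eval · p) =O[𝓝[≠] 0] fun _ => (1 : ℂ) :=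
  (p.continuous.continuousAt.tendsto.mono_left nhdsWithin_le_nhds).isBigO_one ℂ

theorem isBigO_eval_pow {n : ℕ} {p : Polynomial ℂ} (hp : ∀ k < n, p.coeff k = 0) :
    (eval · p) =O[𝓝[≠] 0] fun z => z ^ n := by
  obtain ⟨q, rfl⟩ := Polynomial.X_pow_dvd_iff.2 hp
  simpa using (isBigO_refl (fun z : ℂ => z ^ n) _).mul (isBigO_eval_one q)

namespace HasTaylorExpansion

open PowerSeries

variable {n : ℕ} {f g : ℂ → ℂ} {p q : PowerSeries ℂ}

theorem of_polynomial {P : Polynomial ℂ} (hf : (fun z => f z - eval z P) =O[𝓝[≠] 0] fun z => z ^ n)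
    (hP : ∀ k < n, P.coeff k = coeff k p) : HasTaylorExpansion n f p := by
  have hdiff : (eval · (P - p.trunc n)) =O[𝓝[≠] 0] fun z => z ^ n :=
    isBigO_eval_pow fun k hk => by
      rw [Polynomial.coeff_sub, coeff_trunc, if_pos hk, hP k hk, sub_self]
  exact (hf.add hdiff).congr_left fun z => by rw [Polynomial.eval_sub, sub_add_sub_cancel]

theorem congr (hf : HasTaylorExpansion n f p) (hpq : ∀ k < n, coeff k p = coeff k q) :
    HasTaylorExpansion n f q :=
  of_polynomial hf fun k hk => by rw [coeff_trunc, if_pos hk, hpq k hk]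

theorem isBigO_pow {m : ℕ} (hf : HasTaylorExpansion n f p) (hmn : m ≤ n)
    (hp : ∀ k < m, coeff k p = 0) : f =O[𝓝[≠] 0] fun z => z ^ m := by
  have hpow : (fun z : ℂ => z ^ n) =O[𝓝[≠] 0] fun z => z ^ m := by
    simpa using isBigO_eval_pow (p := .X ^ n) (n := m) fun k hk => by
      rw [Polynomial.coeff_X_pow, if_neg (by omega)]
  have htrunc : (eval · (p.trunc n)) =O[𝓝[≠] 0] fun z => z ^ m :=
    isBigO_eval_pow fun k hk => by rw [coeff_trunc, if_pos (by omega), hp k hk]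
  exact ((IsBigO.trans hf hpow).add htrunc).congr_left fun z => sub_add_cancel _ _

theorem isBigO_one (hf : HasTaylorExpansion n f p) : f =O[𝓝[≠] 0] fun _ => (1 : ℂ) := by
  simpa using hf.isBigO_pow n.zero_le (by simp)

theorem const (n : ℕ) (c : ℂ) : HasTaylorExpansion n (fun _ => c) (C c) :=
  of_polynomial (P := .C c) (by simpa using isBigO_zero _ _) fun k _ => by
    rw [Polynomial.coeff_C, coeff_C]

theorem add (hf : HasTaylorExpansion n f p) (hg : HasTaylorExpansion n g q) :
    HasTaylorExpansion n (fun z => f z + g z) (p + q) :=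
  (IsBigO.add hf hg).congr_left fun z => by
    rw [map_add, Polynomial.eval_add, add_sub_add_comm]

theorem sub (hf : HasTaylorExpansion n f p) (hg : HasTaylorExpansion n g q) :
    HasTaylorExpansion n (fun z => f z - g z) (p - q) :=
  (IsBigO.sub hf hg).congr_left fun z => by
    rw [trunc_sub, Polynomial.eval_sub, sub_sub_sub_comm]

theorem mul (hf : HasTaylorExpansion n f p) (hg : HasTaylorExpansion n g q) :
    HasTaylorExpansion n (fun z => f z * g z) (p * q) := by
  have hleft := IsBigO.mul hf hg.isBigO_one
  have hright := (isBigO_eval_one (p.trunc n)).mul hg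
  simp only [mul_one, one_mul] at hleft hright
  refine of_polynomial (P := p.trunc n * q.trunc n) ?_ fun k hk => by
    rw [coeff_mul_eq_coeff_trunc_mul_trunc p q hk, ← Polynomial.coe_mul, Polynomial.coeff_coe]
  refine (hleft.add hright).congr_left fun z => ?_
  rw [Polynomial.eval_mul]
  ring

theorem const_mul (c : ℂ) (hf : HasTaylorExpansion n f p) :
    HasTaylorExpansion n (fun z => c * f z) (C c * p) :=
  (const n c).mul hf

theorem pow (hf : HasTaylorExpansion n f p) (k : ℕ) :
    HasTaylorExpansion n (fun z => f z ^ k) (p ^ k) := by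
  induction k with
  | zero => simpa using const n 1
  | succ k ih => simpa only [pow_succ] using ih.mul hf

theorem sum {ι : Type*} {f : ι → ℂ → ℂ} {p : ι → PowerSeries ℂ} (s : Finset ι)
    (hf : ∀ i ∈ s, HasTaylorExpansion n (f i) (p i)) :
    HasTaylorExpansion n (fun z => ∑ i ∈ s, f i z) (∑ i ∈ s, p i) :=
  (IsBigO.sum hf).congr_left fun z => by
    rw [Finset.sum_apply, Finset.sum_sub_distrib, map_sum, Polynomial.eval_finsetSum]

theorem div_id (hf : HasTaylorExpansion (n + 1) f (X * p)) :
    HasTaylorExpansion n (fun z => f z / z) p := by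
  have htrunc : (X * p).trunc (n + 1) = .X * p.trunc n := by
    ext (_ | k) <;> simp [coeff_trunc, coeff_succ_X_mul]
  refine (IsBigO.mul hf (isBigO_refl (fun z : ℂ => z⁻¹) _)).congr' ?_ ?_ <;>
    filter_upwards [self_mem_nhdsWithin] with z hz
  · rw [htrunc, Polynomial.eval_mul, Polynomial.eval_X]
    field_simp [show z ≠ 0 from hz]
  · rw [pow_succ, mul_inv_cancel_right₀ hz]

theorem exp_mul (n : ℕ) (c : ℂ) :
    HasTaylorExpansion n (fun z => Complex.exp (c * z))
      (PowerSeries.mk fun k => c ^ k / k.factorial) := by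
  have hlim : Tendsto (fun z : ℂ => c * z) (𝓝[≠] 0) (𝓝 0) :=
    ((continuous_const_mul c).tendsto' 0 0 (mul_zero c)).mono_left nhdsWithin_le_nhds
  have hpow : (fun z : ℂ => (c * z) ^ n) =O[𝓝[≠] 0] fun z => z ^ n := by
    simpa only [mul_pow] using isBigO_const_mul_self (c ^ n) _ _
  refine (((Complex.exp_sub_sum_range_isBigO_pow n).comp_tendsto hlim).trans hpow).congr_left
    fun z => ?_
  simp [trunc_apply, Polynomial.eval_finsetSum, mul_pow, div_mul_eq_mul_div]

theorem one_add_cpow (a : ℂ) (hf : HasTaylorExpansion n f p) (hn : n ≠ 0) (hp : coeff 0 p = 0) :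
    HasTaylorExpansion n (fun z => (1 + f z) ^ a)
      (∑ k ∈ Finset.range n, C (Ring.choose a k) * p ^ k) := by
  have hfO : f =O[𝓝[≠] 0] fun z => z := by
    simpa using hf.isBigO_pow (m := 1) (by omega) (by simpa using hp)
  have hlim : Tendsto f (𝓝[≠] 0) (𝓝 0) := hfO.trans_tendsto nhdsWithin_le_nhds
  have hbinom : (fun z => (1 + f z) ^ a - ∑ k ∈ Finset.range n, Ring.choose a k * f z ^ k)
      =O[𝓝[≠] 0] fun z => z ^ n := by
    refine ((((Complex.one_add_cpow_hasFPowerSeriesAt_zero (a := a)).isBigO_sub_partialSum_pow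
      n).comp_tendsto hlim).trans (hfO.norm_left.pow n)).congr_left fun z => ?_
    simp [FormalMultilinearSeries.partialSum, -FormalMultilinearSeries.apply_eq_prod_smul_coeff]
  have hsum : HasTaylorExpansion n (fun z => ∑ k ∈ Finset.range n, Ring.choose a k * f z ^ k)
      (∑ k ∈ Finset.range n, C (Ring.choose a k) * p ^ k) :=
    sum _ fun k _ => (hf.pow k).const_mul _
  exact (hbinom.add hsum).congr_left fun z => by rw [sub_add_sub_cancel]

theorem one_sub_exp_neg_div (n : ℕ) :
    HasTaylorExpansion n (fun z => (1 - Complex.exp (-z)) / z)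
      (PowerSeries.mk fun k => (-1) ^ k / (k + 1).factorial) := by
  have hseries : C 1 - PowerSeries.mk (fun k => (-1 : ℂ) ^ k / k.factorial)
      = X * PowerSeries.mk fun k => (-1 : ℂ) ^ k / (k + 1).factorial := by
    ext (_ | k)
    · simp
    · simp [coeff_succ_X_mul, pow_succ, neg_div]
  have h := (const (n + 1) 1).sub (exp_mul (n + 1) (-1))
  simp only [hseries, neg_one_mul] at h
  exact h.div_id

end HasTaylorExpansion

end TaylorExpansions

section Symbols

open Asymptotics Filter Topology

/-- The Fourier symbol of the three-point stencil `v ↦ a v(x - 1) + b v(x) + c v(x + 1)`. -/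
noncomputable def threePointSymbol (a b c : ℝ) (z : ℂ) : ℂ :=
  a * Complex.exp (-z) + b + c * Complex.exp z

theorem hasTaylorExpansion_threePointSymbol (a b c : ℝ) (n : ℕ) :
    HasTaylorExpansion n (threePointSymbol a b c)
      (.mk fun
        | 0 => a + b + c
        | k + 1 => (a * (-1) ^ (k + 1) + c) / (k + 1).factorial) := by
  have h := (((HasTaylorExpansion.exp_mul n (-1)).const_mul a).add
    (.const n b)).add ((HasTaylorExpansion.exp_mul n 1).const_mul c)
  simp only [neg_one_mul, one_mul] at h
  refine HasTaylorExpansion.congr h fun k _ => ?_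
  rcases k with _ | k
  · simp
  · simp [div_eq_mul_inv, mul_assoc, add_mul]

theorem choose_succ_eq_div {K : Type*} [Field K] [CharZero K] (a : K) (k : ℕ) :
    Ring.choose a (k + 1) = Ring.choose a k * (a - k) / (k + 1) := by
  rw [eq_div_iff k.cast_add_one_ne_zero, mul_comm]
  simpa using Ring.choose_smul_choose a (Nat.le_add_right k 1)

theorem hasTaylorExpansion_one_sub_exp_neg_div_cpow (a : ℂ) :
    HasTaylorExpansion 5 (fun z => ((1 - Complex.exp (-z)) / z) ^ a)
      (.mk fun
        | 0 => 1
        | 1 => -a / 2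
        | 2 => a * (3 * a + 1) / 24
        | 3 => -a ^ 2 * (a + 1) / 48
        | 4 => a * (15 * a ^ 3 + 30 * a ^ 2 + 5 * a - 2) / 5760
        | _ => 0) := by
  have hbase : HasTaylorExpansion 5 (fun z => (1 - Complex.exp (-z)) / z - 1)
      (.mk fun
        | 0 => 0
        | k + 1 => (-1) ^ (k + 1) / (k + 2).factorial) :=
    ((HasTaylorExpansion.one_sub_exp_neg_div 5).sub (.const 5 1)).congr fun k _ => by
      rcases k with _ | k <;> simp
  have hpower := hbase.one_add_cpow a (by norm_num) (by simp)
  simp only [add_sub_cancel] at hpower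
  refine hpower.congr fun k hk => ?_
  interval_cases k <;>
  · simp only [Finset.sum_range_succ, Finset.sum_range_zero, map_add, pow_succ, pow_zero,
      one_mul, PowerSeries.coeff_one, PowerSeries.coeff_mul,
      Finset.Nat.sum_antidiagonal_eq_sum_range_succ_mk, PowerSeries.coeff_mk, Nat.reduceSub,
      choose_succ_eq_div, Ring.choose_zero_right, Nat.factorial, mul_zero, zero_mul, add_zero,
      zero_add]
    norm_num <;> ring

/-- The symbols `Q` and `S` are consistent to order `n` at order of differentiation `α` if
`Q z = ((1 - exp (-z)) / z) ^ α * S z + O(z ^ n)` as `z → 0`: the stencil with symbol `Q` applied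
to the tempered derivative agrees to order `n` with the stencil with symbol `S` applied to the
Grünwald difference quotient, whose symbol is `(1 - exp (-z)) ^ α`. -/
def IsConsistent (n : ℕ) (α : ℝ) (Q S : ℂ → ℂ) : Prop :=
  (fun z => Q z - ((1 - Complex.exp (-z)) / z) ^ (α : ℂ) * S z) =O[𝓝[≠] 0] fun z => z ^ n

theorem isConsistent_quasiCompact {α : ℝ} (hden : coeffDen α ≠ 0) :
    IsConsistent 5 α (threePointSymbol (coeffM α) 1 (coeffN α))
      (threePointSymbol (coeffMuNegOne α) (coeffMuZero α) (coeffMuOne α)) := by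
  have hd : (coeffDen α : ℂ) ≠ 0 := by exact_mod_cast hden
  refine ((hasTaylorExpansion_threePointSymbol _ _ _ 5).sub
    ((hasTaylorExpansion_one_sub_exp_neg_div_cpow α).mul
      (hasTaylorExpansion_threePointSymbol _ _ _ 5))).isBigO_pow le_rfl fun k hk => ?_
  interval_cases k <;>
  · simp only [map_sub, PowerSeries.coeff_mul, Finset.Nat.sum_antidiagonal_eq_sum_range_succ_mk,
      Finset.sum_range_succ, Finset.sum_range_zero, PowerSeries.coeff_mk, Nat.reduceSub,
      Nat.factorial, coeffM, coeffN, coeffMuNegOne, coeffMuZero, coeffMuOne]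
    push_cast
    field_simp
    simp only [coeffDen]
    push_cast
    ring

theorem norm_exp_neg_le_one {z : ℂ} (hz : 0 ≤ z.re) : ‖Complex.exp (-z)‖ ≤ 1 := by
  rw [Complex.norm_exp]
  simpa using hz

theorem norm_threePointSymbol_le (a b c : ℝ) {z : ℂ} {R : ℝ} (hz : 0 ≤ z.re) (hzR : z.re ≤ R) :
    ‖threePointSymbol a b c z‖ ≤ |a| + |b| + |c| * Real.exp R := by
  have hexp : ‖Complex.exp z‖ ≤ Real.exp R := by
    rw [Complex.norm_exp]
    exact Real.exp_le_exp.2 hzR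
  refine norm_add₃_le.trans ?_
  simp only [norm_mul, Complex.norm_real, Real.norm_eq_abs]
  gcongr
  exact mul_le_of_le_one_right (abs_nonneg _) (norm_exp_neg_le_one hz)

/-- The symbol of the truncation error of a pair of stencils with symbols `Q` and `S`, multiplied by
the `α`-th power of the step size. -/
noncomputable def symbolDefect (α : ℝ) (Q S : ℂ → ℂ) (z : ℂ) : ℂ :=
  z ^ (α : ℂ) * Q z - (1 - Complex.exp (-z)) ^ (α : ℂ) * S z

theorem mul_cpow_of_re {z w : ℂ} (hz₀ : z ≠ 0) (hz : 0 ≤ z.re) (hw : 0 < w.re) (a : ℂ) :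
    (z * w) ^ a = z ^ a * w ^ a := by
  have hw₀ : w ≠ 0 := by rintro rfl; simp at hw
  have hargz := abs_le.1 (Complex.abs_arg_le_pi_div_two_iff.2 hz)
  have hargw := abs_lt.1 (Complex.abs_arg_lt_pi_div_two_iff.2 (.inl hw))
  rw [Complex.cpow_def_of_ne_zero (mul_ne_zero hz₀ hw₀), Complex.cpow_def_of_ne_zero hz₀,
    Complex.cpow_def_of_ne_zero hw₀, Complex.log_mul hz₀ hw₀ ⟨by linarith, by linarith⟩,
    add_mul, Complex.exp_add]

theorem eventually_re_one_sub_exp_neg_div_pos :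
    ∀ᶠ z : ℂ in 𝓝[≠] 0, 0 < ((1 - Complex.exp (-z)) / z).re := by
  have hO : (fun z : ℂ => (1 - Complex.exp (-z)) / z - 1) =O[𝓝[≠] 0] fun z => z := by
    simpa using ((HasTaylorExpansion.one_sub_exp_neg_div 1).sub (.const 1 1)).isBigO_pow le_rfl
      (by simp)
  have hlim := (Complex.continuous_re.tendsto' 0 0 rfl).comp
    (hO.trans_tendsto (nhdsWithin_le_nhds (a := (0 : ℂ)) (s := {0}ᶜ)))
  filter_upwards [hlim.eventually (lt_mem_nhds (show (-1 : ℝ) < 0 by norm_num))] with z hz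
  simpa using hz

namespace IsConsistent

variable {n : ℕ} {α : ℝ} {Q S : ℂ → ℂ}

theorem exists_norm_symbolDefect_le_near_zero (h : IsConsistent n α Q S) :
    ∃ c : ℝ, ∃ δ > 0, ∀ z : ℂ, z ≠ 0 → ‖z‖ < δ → 0 ≤ z.re →
      ‖symbolDefect α Q S z‖ ≤ c * ‖z‖ ^ (n + α) := by
  obtain ⟨c, hc⟩ := IsBigO.bound h
  obtain ⟨δ, hδ, hball⟩ := Metric.mem_nhdsWithin_iff.1
    (hc.and eventually_re_one_sub_exp_neg_div_pos)
  refine ⟨c, δ, hδ, fun z hz₀ hzδ hz => ?_⟩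
  obtain ⟨hbound, hre⟩ := hball ⟨mem_ball_zero_iff.2 hzδ, hz₀⟩
  rw [norm_pow] at hbound
  have hfactor : symbolDefect α Q S z = z ^ (α : ℂ)
      * (Q z - ((1 - Complex.exp (-z)) / z) ^ (α : ℂ) * S z) := by
    rw [symbolDefect, mul_sub, ← mul_assoc, ← mul_cpow_of_re hz₀ hz hre, mul_div_cancel₀ _ hz₀]
  calc ‖symbolDefect α Q S z‖
      = ‖z‖ ^ α * ‖Q z - ((1 - Complex.exp (-z)) / z) ^ (α : ℂ) * S z‖ := by
        rw [hfactor, norm_mul, Complex.norm_cpow_real]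
    _ ≤ ‖z‖ ^ α * (c * ‖z‖ ^ n) := by gcongr
    _ = c * ‖z‖ ^ (n + α) := by
        rw [Real.rpow_add (norm_pos_iff.2 hz₀), Real.rpow_natCast]
        ring

end IsConsistent

theorem norm_symbolDefect_le {α : ℝ} (hα : 0 ≤ α) {Q S : ℂ → ℂ} {A B : ℝ} {z : ℂ} (hz : 0 ≤ z.re)
    (hQ : ‖Q z‖ ≤ A) (hS : ‖S z‖ ≤ B) : ‖symbolDefect α Q S z‖ ≤ ‖z‖ ^ α * A + 2 ^ α * B := by
  have hdiff : ‖1 - Complex.exp (-z)‖ ≤ 2 := by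
    linarith [norm_sub_le 1 (Complex.exp (-z)), norm_exp_neg_le_one hz, norm_one (α := ℂ)]
  refine (norm_sub_le _ _).trans ?_
  rw [norm_mul, norm_mul, Complex.norm_cpow_real, Complex.norm_cpow_real]
  gcongr

theorem IsConsistent.exists_norm_symbolDefect_le {n : ℕ} {α : ℝ} {Q S : ℂ → ℂ}
    (h : IsConsistent n α Q S) (hα : 0 < α) {s : Set ℂ} (hs : ∀ z ∈ s, 0 ≤ z.re) {A B : ℝ}
    (hQ : ∀ z ∈ s, ‖Q z‖ ≤ A) (hS : ∀ z ∈ s, ‖S z‖ ≤ B) :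
    ∃ C : ℝ, ∀ z ∈ s, ‖symbolDefect α Q S z‖ ≤ C * ‖z‖ ^ (n + α) := by
  obtain ⟨c, δ, hδ, hnear⟩ := h.exists_norm_symbolDefect_le_near_zero
  refine ⟨max c (A / δ ^ n + 2 ^ α * B / δ ^ (n + α)), fun z hz => ?_⟩
  rcases eq_or_ne z 0 with rfl | hz₀
  · have hexponent : (n : ℝ) + α ≠ 0 := by positivity
    simp [symbolDefect, hα.ne', Real.zero_rpow hexponent]
  rcases lt_or_ge ‖z‖ δ with hlt | hge
  · refine (hnear z hz₀ hlt (hs z hz)).trans ?_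
    gcongr
    exact le_max_left _ _
  have hA : 0 ≤ A := (norm_nonneg _).trans (hQ z hz)
  have hB : 0 ≤ B := (norm_nonneg _).trans (hS z hz)
  have hone : 1 ≤ ‖z‖ ^ n / δ ^ n := by rw [one_le_div (by positivity)]; gcongr
  have hone' : 1 ≤ ‖z‖ ^ (n + α) / δ ^ (n + α) := by rw [one_le_div (by positivity)]; gcongr
  calc ‖symbolDefect α Q S z‖ ≤ ‖z‖ ^ α * A + 2 ^ α * B :=
        norm_symbolDefect_le hα.le (hs z hz) (hQ z hz) (hS z hz)
    _ ≤ ‖z‖ ^ α * A * (‖z‖ ^ n / δ ^ n) + 2 ^ α * B * (‖z‖ ^ (n + α) / δ ^ (n + α)) :=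
        add_le_add (le_mul_of_one_le_right (by positivity) hone)
          (le_mul_of_one_le_right (by positivity) hone')
    _ = (A / δ ^ n + 2 ^ α * B / δ ^ (n + α)) * ‖z‖ ^ (n + α) := by
        rw [Real.rpow_add (norm_pos_iff.2 hz₀), Real.rpow_natCast]
        ring
    _ ≤ _ := by gcongr; exact le_max_right _ _

end Symbols

section FourierDecay

open FourierTransform

/-- The point `λ + 2πiω` of the vertical line of abscissa `λ`: the factor by which `d/dx` acts on
`e^{λx}e^{2πiωx}`. -/
noncomputable def verticalLine (lam ω : ℝ) : ℂ := lam + 2 * Real.pi * ω * Complex.I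

@[simp]
theorem verticalLine_re (lam ω : ℝ) : (verticalLine lam ω).re = lam := by
  simp [verticalLine]

@[simp]
theorem verticalLine_im (lam ω : ℝ) : (verticalLine lam ω).im = 2 * Real.pi * ω := by
  simp [verticalLine]

@[fun_prop]
theorem continuous_verticalLine_left (ω : ℝ) : Continuous fun lam => verticalLine lam ω := by
  unfold verticalLine
  fun_prop

@[fun_prop]
theorem continuous_verticalLine (lam : ℝ) : Continuous (verticalLine lam) := by
  unfold verticalLine
  fun_prop

theorem norm_verticalLine_zero (ω : ℝ) : ‖verticalLine 0 ω‖ = 2 * Real.pi * |ω| := by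
  simp [verticalLine, abs_of_pos Real.pi_pos]

theorem norm_verticalLine_zero_le (lam ω : ℝ) : ‖verticalLine 0 ω‖ ≤ ‖verticalLine lam ω‖ := by
  simpa [norm_verticalLine_zero, abs_of_pos Real.pi_pos] using
    Complex.abs_im_le_norm (verticalLine lam ω)

theorem abs_le_norm_verticalLine (lam ω : ℝ) : |ω| ≤ ‖verticalLine lam ω‖ := by
  refine le_trans ?_ (norm_verticalLine_zero_le lam ω)
  rw [norm_verticalLine_zero]
  exact le_mul_of_one_le_left (abs_nonneg ω) (by linarith [Real.two_le_pi])

theorem norm_verticalLine_le (lam ω : ℝ) :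
    ‖verticalLine lam ω‖ ≤ (|lam| + 2 * Real.pi) * (1 + |ω|) := by
  have h := Complex.norm_le_abs_re_add_abs_im (verticalLine lam ω)
  rw [verticalLine_re, verticalLine_im, abs_mul, abs_of_pos Real.two_pi_pos] at h
  nlinarith [abs_nonneg ω, abs_nonneg lam, Real.pi_pos, mul_nonneg (abs_nonneg lam) (abs_nonneg ω)]

theorem integrable_abs_rpow_mul_one_add_abs_rpow {γ r : ℝ} (hγ : -1 < γ) (hγ₀ : γ ≤ 0)
    (hr : 1 < r) : Integrable fun ω : ℝ => |ω| ^ γ * (1 + |ω|) ^ (-r) := by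
  have hlocal : LocallyIntegrable fun ω : ℝ => |ω| ^ γ :=
    locallyIntegrable_of_norm_le_rpow (C := 1) (α := -γ) (by simp) (by simp; linarith)
      (.of_forall fun ω => by simp [abs_of_nonneg (Real.rpow_nonneg (abs_nonneg ω) γ)])
      (by fun_prop : Measurable fun ω : ℝ => |ω| ^ γ).aestronglyMeasurable
  have hnear : Integrable ((Icc (-1 : ℝ) 1).indicator fun ω => |ω| ^ γ) :=
    (integrable_indicator_iff measurableSet_Icc).2 (hlocal.integrableOn_isCompact isCompact_Icc)
  have hfar : Integrable fun ω : ℝ => (1 + ‖ω‖) ^ (-r) := integrable_one_add_norm (by simpa)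
  refine (hnear.add hfar).mono' (by fun_prop) (.of_forall fun ω => ?_)
  rw [Real.norm_of_nonneg (by positivity), Pi.add_apply, Real.norm_eq_abs]
  by_cases hω : ω ∈ Icc (-1 : ℝ) 1
  · rw [indicator_of_mem hω]
    have hle : (1 + |ω|) ^ (-r) ≤ 1 :=
      Real.rpow_le_one_of_one_le_of_nonpos (by linarith [abs_nonneg ω]) (by linarith)
    exact (mul_le_of_le_one_right (by positivity) hle).trans
      (le_add_of_nonneg_right (by positivity))
  · rw [indicator_of_notMem hω, zero_add]
    have hone : 1 ≤ |ω| := le_of_lt (not_le.1 (mt abs_le.1 hω))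
    exact mul_le_of_le_one_left (by positivity) (Real.rpow_le_one_of_one_le_of_nonpos hone hγ₀)

/-- `φ` is measurable and `φ(ω) = O((1 + |ω|)^{-r})` uniformly in `ω`. -/
structure HasDecay (r : ℝ) (φ : ℝ → ℂ) : Prop where
  aestronglyMeasurable : AEStronglyMeasurable φ
  exists_norm_le : ∃ C : ℝ, ∀ ω, ‖φ ω‖ ≤ C * (1 + |ω|) ^ (-r)

namespace HasDecay

variable {r γ : ℝ} {φ : ℝ → ℂ}

theorem aestronglyMeasurable_norm_verticalLine_rpow_mul (hφ : HasDecay r φ) (lam γ : ℝ) :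
    AEStronglyMeasurable fun ω => ‖verticalLine lam ω‖ ^ γ * ‖φ ω‖ :=
  (by fun_prop : Measurable fun ω => ‖verticalLine lam ω‖ ^ γ).aestronglyMeasurable.mul
    hφ.aestronglyMeasurable.norm

theorem integrable_norm_verticalLine_rpow_mul_of_nonpos (hφ : HasDecay r φ) (hr : 1 < r) (lam : ℝ)
    (hγ : -1 < γ) (hγ₀ : γ ≤ 0) : Integrable fun ω => ‖verticalLine lam ω‖ ^ γ * ‖φ ω‖ := by
  obtain ⟨C, hC⟩ := hφ.exists_norm_le
  refine ((integrable_abs_rpow_mul_one_add_abs_rpow hγ hγ₀ hr).const_mul C).mono'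
    (hφ.aestronglyMeasurable_norm_verticalLine_rpow_mul lam γ) ?_
  filter_upwards [Measure.ae_ne volume 0] with ω hω
  rw [Real.norm_of_nonneg (by positivity)]
  calc ‖verticalLine lam ω‖ ^ γ * ‖φ ω‖
      ≤ |ω| ^ γ * (C * (1 + |ω|) ^ (-r)) :=
        mul_le_mul (Real.rpow_le_rpow_of_nonpos (abs_pos.2 hω) (abs_le_norm_verticalLine lam ω) hγ₀)
          (hC ω) (norm_nonneg _) (by positivity)
    _ = C * (|ω| ^ γ * (1 + |ω|) ^ (-r)) := by ring

theorem integrable_norm_verticalLine_rpow_mul_of_nonneg (hφ : HasDecay r φ) (lam : ℝ)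
    (hγ₀ : 0 ≤ γ) (hγr : γ + 1 < r) : Integrable fun ω => ‖verticalLine lam ω‖ ^ γ * ‖φ ω‖ := by
  obtain ⟨C, hC⟩ := hφ.exists_norm_le
  have hbound : Integrable fun ω : ℝ => (1 + ‖ω‖) ^ (-(r - γ)) :=
    integrable_one_add_norm (by simp; linarith)
  refine (hbound.const_mul ((|lam| + 2 * Real.pi) ^ γ * C)).mono'
    (hφ.aestronglyMeasurable_norm_verticalLine_rpow_mul lam γ) (.of_forall fun ω => ?_)
  have hω : 0 < 1 + |ω| := by positivity
  have hlam : 0 ≤ |lam| + 2 * Real.pi := by positivity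
  rw [Real.norm_of_nonneg (by positivity), Real.norm_eq_abs]
  calc ‖verticalLine lam ω‖ ^ γ * ‖φ ω‖
      ≤ ((|lam| + 2 * Real.pi) * (1 + |ω|)) ^ γ * (C * (1 + |ω|) ^ (-r)) := by
        gcongr
        · exact norm_verticalLine_le lam ω
        · exact hC ω
    _ = (|lam| + 2 * Real.pi) ^ γ * C * (1 + |ω|) ^ (-(r - γ)) := by
        rw [Real.mul_rpow hlam hω.le, neg_sub, sub_eq_add_neg, Real.rpow_add hω]
        ring

theorem integrable_norm_verticalLine_rpow_mul (hφ : HasDecay r φ) (hr : 1 < r) (lam : ℝ)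
    (hγ : -1 < γ) (hγr : γ + 1 < r) : Integrable fun ω => ‖verticalLine lam ω‖ ^ γ * ‖φ ω‖ :=
  (le_total γ 0).elim (hφ.integrable_norm_verticalLine_rpow_mul_of_nonpos hr lam hγ)
    (hφ.integrable_norm_verticalLine_rpow_mul_of_nonneg lam · hγr)

theorem integrable_verticalLine_cpow_mul (hφ : HasDecay r φ) (hr : 1 < r) (lam : ℝ)
    (hγ : -1 < γ) (hγr : γ + 1 < r) :
    Integrable fun ω => verticalLine lam ω ^ (γ : ℂ) * φ ω := by
  refine (hφ.integrable_norm_verticalLine_rpow_mul hr lam hγ hγr).mono' ?_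
    (.of_forall fun ω => by rw [norm_mul, Complex.norm_cpow_real])
  exact (by fun_prop : Measurable fun ω => verticalLine lam ω ^ (γ : ℂ)).aestronglyMeasurable.mul
    hφ.aestronglyMeasurable

theorem integrable (hφ : HasDecay r φ) (hr : 1 < r) : Integrable φ := by
  simpa using hφ.integrable_verticalLine_cpow_mul hr 0 (γ := 0) (by norm_num) (by linarith)

end HasDecay

theorem norm_fourier_le_integral_norm (f : ℝ → ℂ) (ω : ℝ) : ‖𝓕 f ω‖ ≤ ∫ x, ‖f x‖ :=
  VectorFourier.norm_fourierIntegral_le_integral_norm _ _ _ _ _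

theorem hasDecay_fourier {v : ℝ → ℂ} {n : ℕ} (hv : ContDiff ℝ n v)
    (hint : ∀ k ≤ n, Integrable (iteratedDeriv k v)) : HasDecay n (𝓕 v) := by
  have hv_int : Integrable v := by simpa using hint 0 n.zero_le
  have hcont : Continuous (𝓕 v) :=
    VectorFourier.fourierIntegral_continuous Real.continuous_fourierChar (by fun_prop) hv_int
  have hderiv (ω : ℝ) : |ω| ^ n * ‖𝓕 v ω‖ ≤ ∫ x, ‖iteratedDeriv n v x‖ := by
    have h := norm_fourier_le_integral_norm (iteratedDeriv n v) ω
    rw [Real.fourier_iteratedDeriv (N := n) (mod_cast hv)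
      (fun k hk => hint k (mod_cast hk)) le_rfl] at h
    have hω : |ω| ≤ ‖2 * Real.pi * Complex.I * ω‖ := by
      simpa [verticalLine, mul_right_comm] using abs_le_norm_verticalLine 0 ω
    refine le_trans ?_ h
    rw [norm_smul, norm_pow]
    gcongr
  refine ⟨hcont.aestronglyMeasurable,
    2 ^ (n - 1) * ((∫ x, ‖v x‖) + ∫ x, ‖iteratedDeriv n v x‖), fun ω => ?_⟩
  rw [Real.rpow_neg (by positivity), Real.rpow_natCast, ← div_eq_mul_inv,
    le_div_iff₀ (by positivity)]
  calc ‖𝓕 v ω‖ * (1 + |ω|) ^ n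
      ≤ ‖𝓕 v ω‖ * (2 ^ (n - 1) * (1 ^ n + |ω| ^ n)) := by
        gcongr
        exact add_pow_le zero_le_one (abs_nonneg ω) n
    _ = 2 ^ (n - 1) * (‖𝓕 v ω‖ + |ω| ^ n * ‖𝓕 v ω‖) := by ring
    _ ≤ _ := by
        gcongr
        exacts [norm_fourier_le_integral_norm v ω, hderiv ω]

end FourierDecay

section InverseFourier

open FourierTransform

theorem fourierInv_eq_integral_verticalLine (f : ℝ → ℂ) (x : ℝ) :
    𝓕⁻ f x = ∫ ω, Complex.exp (verticalLine 0 ω * x) * f ω := by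
  rw [Real.fourierInv_eq']
  refine integral_congr_ae (.of_forall fun ω => ?_)
  simp only [verticalLine, smul_eq_mul, RCLike.inner_apply, conj_trivial]
  push_cast
  ring_nf

theorem norm_fourierInv_le_integral_norm (f : ℝ → ℂ) (x : ℝ) : ‖𝓕⁻ f x‖ ≤ ∫ ω, ‖f ω‖ := by
  rw [Real.fourierInv_eq_fourier_neg]
  exact norm_fourier_le_integral_norm f (-x)

theorem continuous_fourierInv {f : ℝ → ℂ} (hf : Integrable f) : Continuous (𝓕⁻ f) := by
  have h : Continuous (𝓕 f) :=
    VectorFourier.fourierIntegral_continuous Real.continuous_fourierChar (by fun_prop) hf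
  rw [funext (Real.fourierInv_eq_fourier_neg f)]
  fun_prop

theorem norm_cexp_verticalLine_mul (lam ω y : ℝ) :
    ‖Complex.exp (verticalLine lam ω * y)‖ = Real.exp (lam * y) := by
  simp [Complex.norm_exp]

theorem integrable_cexp_verticalLine_mul {f : ℝ → ℂ} (hf : Integrable f) (lam y : ℝ) :
    Integrable fun ω => Complex.exp (verticalLine lam ω * y) * f ω :=
  hf.bdd_mul (by fun_prop) (.of_forall fun ω => (norm_cexp_verticalLine_mul lam ω y).le)

theorem fourierInv_sub {f g : ℝ → ℂ} (hf : Integrable f) (hg : Integrable g) (x : ℝ) :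
    𝓕⁻ (fun ω => f ω - g ω) x = 𝓕⁻ f x - 𝓕⁻ g x := by
  simp only [fourierInv_eq_integral_verticalLine, mul_sub]
  exact integral_sub (integrable_cexp_verticalLine_mul hf 0 x)
    (integrable_cexp_verticalLine_mul hg 0 x)

theorem fourierInv_add {f g : ℝ → ℂ} (hf : Integrable f) (hg : Integrable g) (x : ℝ) :
    𝓕⁻ (fun ω => f ω + g ω) x = 𝓕⁻ f x + 𝓕⁻ g x := by
  simp only [fourierInv_eq_integral_verticalLine, mul_add]
  exact integral_add (integrable_cexp_verticalLine_mul hf 0 x)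
    (integrable_cexp_verticalLine_mul hg 0 x)

theorem fourierInv_const_mul (c : ℂ) (f : ℝ → ℂ) (x : ℝ) :
    𝓕⁻ (fun ω => c * f ω) x = c * 𝓕⁻ f x := by
  simp only [fourierInv_eq_integral_verticalLine, mul_left_comm _ c, integral_const_mul]

theorem cexp_mul_fourierInv_add (lam : ℝ) (f : ℝ → ℂ) (x y : ℝ) :
    Complex.exp (lam * y) * 𝓕⁻ f (x + y)
      = 𝓕⁻ (fun ω => Complex.exp (verticalLine lam ω * y) * f ω) x := by
  simp only [fourierInv_eq_integral_verticalLine, ← integral_const_mul, ← mul_assoc,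
    ← Complex.exp_add]
  congr! 4
  simp only [verticalLine]
  push_cast
  ring

theorem hasDerivAt_fourierInv {f : ℝ → ℂ} (hf : Integrable f)
    (hf' : Integrable fun ω => verticalLine 0 ω * f ω) (x : ℝ) :
    HasDerivAt (𝓕⁻ f) (𝓕⁻ (fun ω => verticalLine 0 ω * f ω) x) x := by
  have hmul : Integrable fun ω : ℝ => ω • f ω := by
    refine (hf'.const_mul (2 * Real.pi * Complex.I)⁻¹).congr (.of_forall fun ω => ?_)
    simp only [verticalLine, Complex.real_smul]
    field_simp [Complex.I_ne_zero]
    simp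
  have h := (Real.hasDerivAt_fourier hf hmul (-x)).scomp x (hasDerivAt_neg x)
  rw [← Real.fourierInv_eq_fourier_neg, neg_one_smul, ← neg_one_mul, ← fourierInv_const_mul] at h
  convert! h using 1
  · exact funext (Real.fourierInv_eq_fourier_neg f)
  · congr! 2 with ω
    simp only [verticalLine, smul_eq_mul]
    push_cast
    ring

theorem hasDerivAt_cexp_mul_fourierInv {lam : ℝ} {f : ℝ → ℂ} (hf : Integrable f)
    (hf' : Integrable fun ω => verticalLine lam ω * f ω) (x : ℝ) :
    HasDerivAt (fun x : ℝ => Complex.exp (lam * x) * 𝓕⁻ f x)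
      (Complex.exp (lam * x) * 𝓕⁻ (fun ω => verticalLine lam ω * f ω) x) x := by
  have hzero : (fun ω => verticalLine 0 ω * f ω)
      = fun ω => verticalLine lam ω * f ω - lam * f ω := by
    funext ω
    simp only [verticalLine]
    push_cast
    ring
  have hinv := hasDerivAt_fourierInv hf (by rw [hzero]; exact hf'.sub (hf.const_mul _)) x
  rw [hzero, fourierInv_sub hf' (hf.const_mul _), fourierInv_const_mul] at hinv
  have hexp : HasDerivAt (fun x : ℝ => Complex.exp (lam * x)) (Complex.exp (lam * x) * lam) x := by
    simpa using ((Complex.ofRealCLM.hasDerivAt (x := x)).const_mul (lam : ℂ)).cexp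
  refine (hexp.mul hinv).congr_deriv ?_
  ring

theorem iteratedDeriv_eq_of_hasDerivAt {E : Type*} [NormedAddCommGroup E] [NormedSpace ℝ E]
    {F : ℕ → ℝ → E} {n : ℕ} (hF : ∀ k < n, ∀ x, HasDerivAt (F k) (F (k + 1) x) x) :
    ∀ k ≤ n, iteratedDeriv k (F 0) = F k
  | 0, _ => iteratedDeriv_zero
  | k + 1, hk => by
    rw [iteratedDeriv_succ, iteratedDeriv_eq_of_hasDerivAt hF k (by omega)]
    exact funext fun x => (hF k hk x).deriv

theorem contDiff_of_hasDerivAt {E : Type*} [NormedAddCommGroup E] [NormedSpace ℝ E]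
    {F : ℕ → ℝ → E} {n : ℕ} (hF : ∀ k < n, ∀ x, HasDerivAt (F k) (F (k + 1) x) x)
    (hcont : Continuous (F n)) : ContDiff ℝ n (F 0) := by
  refine contDiff_nat_iff_iteratedDeriv.2 ⟨fun k hk => ?_, fun k hk => ?_⟩
  · rw [iteratedDeriv_eq_of_hasDerivAt hF k hk]
    rcases hk.lt_or_eq with hlt | rfl
    · exact continuous_iff_continuousAt.2 fun x => (hF k hlt x).continuousAt
    · exact hcont
  · rw [iteratedDeriv_eq_of_hasDerivAt hF k hk.le]
    exact fun x => (hF k hk x).differentiableAt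

theorem iteratedDeriv_ofReal_comp {u : ℝ → ℝ} {n : ℕ} (hu : ContDiff ℝ n u) :
    iteratedDeriv n (fun x => (u x : ℂ)) = fun x => ((iteratedDeriv n u x : ℝ) : ℂ) := by
  funext x
  have h := Complex.ofRealCLM.iteratedFDeriv_comp_left (x := x) hu.contDiffAt le_rfl
  exact DFunLike.congr_fun h fun _ => 1

end InverseFourier

section ComplexGammaIntegral

open Filter Topology ProbabilityTheory

/-- The measure `t^{a-1} dt` on `(0, ∞)`, whose complex moment generating function in the variable
`-t` is the Laplace transform `∫ t^{a-1}e^{-zt} dt`. -/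
noncomputable def powerMeasure (a : ℝ) : Measure ℝ :=
  (volume.restrict (Ioi 0)).withDensity fun t => ENNReal.ofReal (t ^ (a - 1))

theorem complexMGF_neg_powerMeasure (a : ℝ) (z : ℂ) :
    complexMGF Neg.neg (powerMeasure a) z
      = ∫ t in Ioi (0 : ℝ), ((t ^ (a - 1) : ℝ) : ℂ) * Complex.exp (-z * t) := by
  rw [complexMGF, powerMeasure, integral_withDensity_eq_integral_toReal_smul (by fun_prop)
    (.of_forall fun _ => ENNReal.ofReal_lt_top)]
  refine setIntegral_congr_fun measurableSet_Ioi fun t (ht : 0 < t) => ?_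
  simp [ENNReal.toReal_ofReal (Real.rpow_nonneg ht.le _)]

theorem Ioi_subset_integrableExpSet_powerMeasure {a : ℝ} (ha : 0 < a) :
    Ioi 0 ⊆ integrableExpSet Neg.neg (powerMeasure a) := by
  intro r (hr : 0 < r)
  rw [integrableExpSet, mem_ofPred, powerMeasure, integrable_withDensity_iff_integrable_smul'
    (by fun_prop) (.of_forall fun _ => ENNReal.ofReal_lt_top)]
  have h := integrableOn_rpow_mul_exp_neg_mul_rpow (s := a - 1) (p := 1) (by linarith) one_pos hr
  refine h.congr_fun (fun t (ht : 0 < t) => ?_) measurableSet_Ioi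
  simp [ENNReal.toReal_ofReal (Real.rpow_nonneg ht.le _)]

theorem analyticOnNhd_integral_rpow_mul_cexp_neg_mul {a : ℝ} (ha : 0 < a) :
    AnalyticOnNhd ℂ
      (fun z : ℂ => ∫ t in Ioi (0 : ℝ), ((t ^ (a - 1) : ℝ) : ℂ) * Complex.exp (-z * t))
      {z | 0 < z.re} := by
  simp_rw [← complexMGF_neg_powerMeasure]
  exact analyticOnNhd_complexMGF.mono fun z hz =>
    interior_maximal (Ioi_subset_integrableExpSet_powerMeasure ha) isOpen_Ioi hz

theorem integral_rpow_mul_cexp_neg_ofReal_mul {a r : ℝ} (ha : 0 < a) (hr : 0 < r) :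
    ∫ t in Ioi (0 : ℝ), ((t ^ (a - 1) : ℝ) : ℂ) * Complex.exp (-r * t)
      = Real.Gamma a * (r : ℂ) ^ (-(a : ℂ)) := by
  have h := Real.integral_rpow_mul_exp_neg_mul_Ioi ha hr
  rw [one_div, Real.inv_rpow hr.le, ← Real.rpow_neg hr.le, mul_comm] at h
  rw [← Complex.ofReal_neg a, ← Complex.ofReal_cpow hr.le, ← Complex.ofReal_mul, ← h,
    ← integral_complex_ofReal]
  simp

theorem integral_rpow_mul_cexp_neg_mul {a : ℝ} (ha : 0 < a) {z : ℂ} (hz : 0 < z.re) :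
    ∫ t in Ioi (0 : ℝ), ((t ^ (a - 1) : ℝ) : ℂ) * Complex.exp (-z * t)
      = Real.Gamma a * z ^ (-(a : ℂ)) := by
  have hopen : IsOpen {z : ℂ | 0 < z.re} := isOpen_lt continuous_const Complex.continuous_re
  have hpow : AnalyticOnNhd ℂ (fun z : ℂ => Real.Gamma a * z ^ (-(a : ℂ))) {z | 0 < z.re} :=
    DifferentiableOn.analyticOnNhd (fun z hz =>
      ((differentiableAt_id.cpow_const (.inl hz)).const_mul _).differentiableWithinAt) hopen
  have hreal : Tendsto (fun r : ℝ => (r : ℂ)) (𝓝[≠] 1) (𝓝[≠] 1) :=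
    (Complex.continuous_ofReal.tendsto' 1 1 Complex.ofReal_one).inf (by simp)
  refine (analyticOnNhd_integral_rpow_mul_cexp_neg_mul ha).eqOn_of_preconnected_of_frequently_eq
    hpow (convex_halfSpace_re_gt 0).isPreconnected (z₀ := 1) (by simp)
    (hreal.frequently (Eventually.frequently ?_)) hz
  filter_upwards [nhdsWithin_le_nhds (lt_mem_nhds one_pos)] with r hr
    using integral_rpow_mul_cexp_neg_ofReal_mul ha hr

end ComplexGammaIntegral

section WeylIntegral

open FourierTransform

theorem integrable_rpow_mul_cexp_verticalLine_prod {φ : ℝ → ℂ} (hφ : Integrable φ) {a lam : ℝ}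
    (ha : 0 < a) (hlam : 0 < lam) :
    Integrable (fun p : ℝ × ℝ => ((p.1 ^ (a - 1) : ℝ) : ℂ)
      * (Complex.exp (-verticalLine lam p.2 * p.1) * φ p.2))
      ((volume.restrict (Ioi 0)).prod volume) := by
  have hkernel : IntegrableOn (fun t : ℝ => t ^ (a - 1) * Real.exp (-lam * t)) (Ioi 0) := by
    simpa using integrableOn_rpow_mul_exp_neg_mul_rpow (s := a - 1) (p := 1) (by linarith)
      one_pos hlam
  refine ((hkernel.integrable.ofReal (𝕜 := ℂ)).mul_prod hφ).congr' ?_ (.of_forall fun p => ?_)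
  · have hmeas : Measurable fun p : ℝ × ℝ =>
        ((p.1 ^ (a - 1) : ℝ) : ℂ) * Complex.exp (-verticalLine lam p.2 * p.1) := by
      unfold verticalLine
      fun_prop
    simp only [← mul_assoc]
    exact hmeas.aestronglyMeasurable.mul (hφ.aestronglyMeasurable.comp_snd)
  · simp [Complex.norm_exp, mul_assoc]

theorem integral_rpow_mul_fourierInv {φ : ℝ → ℂ} (hφ : Integrable φ) {a lam : ℝ}
    (ha : 0 < a) (hlam : 0 < lam) (x : ℝ) :
    ∫ t in Ioi (0 : ℝ), ((t ^ (a - 1) : ℝ) : ℂ)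
        * 𝓕⁻ (fun ω => Complex.exp (-verticalLine lam ω * t) * φ ω) x
      = Real.Gamma a * 𝓕⁻ (fun ω => verticalLine lam ω ^ (-(a : ℂ)) * φ ω) x := by
  have hprod := (integrable_rpow_mul_cexp_verticalLine_prod hφ ha hlam).bdd_mul (c := 1)
    (f := fun p : ℝ × ℝ => Complex.exp (verticalLine 0 p.2 * x))
    (by fun_prop) (.of_forall fun p => by simp [norm_cexp_verticalLine_mul])
  simp only [fourierInv_eq_integral_verticalLine, ← integral_const_mul]
  rw [integral_integral_swap (hprod.congr (.of_forall fun p => mul_left_comm _ _ _))]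
  congr with ω
  calc ∫ t in Ioi (0 : ℝ), ((t ^ (a - 1) : ℝ) : ℂ)
        * (Complex.exp (verticalLine 0 ω * x) * (Complex.exp (-verticalLine lam ω * t) * φ ω))
      = Complex.exp (verticalLine 0 ω * x) * φ ω * ∫ t in Ioi (0 : ℝ),
          ((t ^ (a - 1) : ℝ) : ℂ) * Complex.exp (-verticalLine lam ω * t) := by
        rw [← integral_const_mul]
        congr with t
        ring
    _ = Real.Gamma a
          * (Complex.exp (verticalLine 0 ω * x) * (verticalLine lam ω ^ (-(a : ℂ)) * φ ω)) := by
        rw [integral_rpow_mul_cexp_neg_mul ha (by simpa using hlam)]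
        ring

theorem continuousOn_integral_cexp_neg_mul {g : ℝ → ℂ} (hg : IntegrableOn g (Ioi 0)) :
    ContinuousOn (fun lam : ℝ => ∫ t in Ioi (0 : ℝ), Complex.exp (-lam * t) * g t) (Ici 0) := by
  refine continuousOn_of_dominated (bound := fun t => ‖g t‖) (fun lam _ => ?_)
    (fun lam (hlam : 0 ≤ lam) => ?_) hg.norm (.of_forall fun t => by fun_prop)
  · exact (by fun_prop : Continuous fun t : ℝ => Complex.exp (-lam * t)).aestronglyMeasurable.mul
      hg.aestronglyMeasurable
  · filter_upwards [ae_restrict_mem measurableSet_Ioi] with t (ht : 0 < t)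
    rw [norm_mul, Complex.norm_exp]
    refine mul_le_of_le_one_left (norm_nonneg _) (Real.exp_le_one_iff.2 ?_)
    simpa using mul_nonneg hlam ht.le

theorem HasDecay.continuous_fourierInv_verticalLine_cpow_mul {r : ℝ} {φ : ℝ → ℂ}
    (hφ : HasDecay r φ) (hr : 1 < r) {γ : ℝ} (hγ : -1 < γ) (hγ₀ : γ ≤ 0) (x : ℝ) :
    Continuous fun lam => 𝓕⁻ (fun ω => verticalLine lam ω ^ (γ : ℂ) * φ ω) x := by
  simp only [fourierInv_eq_integral_verticalLine]
  refine continuous_of_dominated (bound := fun ω => ‖verticalLine 0 ω‖ ^ γ * ‖φ ω‖)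
    (fun lam => (integrable_cexp_verticalLine_mul
      (hφ.integrable_verticalLine_cpow_mul hr lam hγ (by linarith)) 0 x).aestronglyMeasurable)
    (fun lam => ?_) (hφ.integrable_norm_verticalLine_rpow_mul hr 0 hγ (by linarith)) ?_
  all_goals filter_upwards [Measure.ae_ne volume 0] with ω hω
  · rw [norm_mul, norm_cexp_verticalLine_mul, zero_mul, Real.exp_zero, one_mul, norm_mul,
      Complex.norm_cpow_real]
    have hpos : 0 < ‖verticalLine 0 ω‖ :=
      (abs_pos.2 hω).trans_le (abs_le_norm_verticalLine 0 ω)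
    exact mul_le_mul_of_nonneg_right
      (Real.rpow_le_rpow_of_nonpos hpos (norm_verticalLine_zero_le lam ω) hγ₀) (norm_nonneg _)
  · have hslit (lam : ℝ) : verticalLine lam ω ∈ Complex.slitPlane :=
      .inr (by simpa [Real.pi_ne_zero] using hω)
    exact continuous_const.mul (((continuous_verticalLine_left ω).cpow continuous_const hslit).mul
      continuous_const)

theorem HasDecay.integral_rpow_mul_cexp_mul_fourierInv {r : ℝ} {φ : ℝ → ℂ} (hφ : HasDecay r φ)
    (hr : 1 < r) {a lam : ℝ} (ha₀ : 0 < a) (ha₁ : a < 1) (hlam : 0 ≤ lam) {x : ℝ}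
    (hint : IntegrableOn (fun t => ((t ^ (a - 1) : ℝ) : ℂ) * 𝓕⁻ φ (x - t)) (Ioi 0)) :
    ∫ t in Ioi (0 : ℝ), Complex.exp (-lam * t) * (((t ^ (a - 1) : ℝ) : ℂ) * 𝓕⁻ φ (x - t))
      = Real.Gamma a * 𝓕⁻ (fun ω => verticalLine lam ω ^ (-(a : ℂ)) * φ ω) x := by
  have hright := hφ.continuous_fourierInv_verticalLine_cpow_mul hr (γ := -a) (by linarith)
    (by linarith) x
  simp only [Complex.ofReal_neg] at hright
  refine EqOn.of_subset_closure (s := Ioi 0) (fun μ hμ => ?_)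
    (continuousOn_integral_cexp_neg_mul hint)
    (hright.const_mul _).continuousOn Ioi_subset_Ici_self
    (closure_Ioi (0 : ℝ)).ge hlam
  rw [← integral_rpow_mul_fourierInv (hφ.integrable hr) ha₀ hμ]
  congr! 2 with t
  have h := cexp_mul_fourierInv_add μ φ x (-t)
  push_cast [← sub_eq_add_neg, mul_neg, ← neg_mul] at h
  rw [← h]
  ring

end WeylIntegral

section RiemannLiouville

open FourierTransform

theorem natCeil_sub_pos {α : ℝ} (hα : ∀ k : ℕ, α ≠ k) : 0 < (⌈α⌉₊ : ℝ) - α :=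
  sub_pos.2 ((Nat.le_ceil α).lt_of_ne (hα _))

theorem natCeil_sub_lt_one {α : ℝ} (hα₀ : 0 ≤ α) : (⌈α⌉₊ : ℝ) - α < 1 := by
  linarith [Nat.ceil_lt_add_one hα₀]

theorem self_mul_cpow {a : ℝ} (ha : -1 < a) (z : ℂ) : z * z ^ (a : ℂ) = z ^ ((a + 1 : ℝ) : ℂ) := by
  rcases eq_or_ne z 0 with rfl | hz
  · rw [zero_mul, Complex.zero_cpow (by exact_mod_cast (by linarith : a + 1 ≠ 0))]
  · rw [Complex.ofReal_add, Complex.ofReal_one, Complex.cpow_add _ _ hz, Complex.cpow_one, mul_comm]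

theorem integrableOn_rpow_sub_one_mul {g : ℝ → ℝ} {a B : ℝ} (ha₀ : 0 < a) (ha₁ : a ≤ 1)
    (hg : IntegrableOn g (Ioi 0)) (hB : ∀ t, 0 < t → |g t| ≤ B) :
    IntegrableOn (fun t : ℝ => t ^ (a - 1) * g t) (Ioi 0) := by
  rw [← Ioc_union_Ioi_eq_Ioi (zero_le_one (α := ℝ)), integrableOn_union]
  constructor
  · have hpow : IntegrableOn (fun t : ℝ => t ^ (a - 1)) (Ioc 0 1) :=
      (intervalIntegrable_iff_integrableOn_Ioc_of_le zero_le_one).1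
        (intervalIntegral.intervalIntegrable_rpow' (by linarith))
    refine Integrable.mul_bdd (c := B) hpow (hg.mono_set Ioc_subset_Ioi_self).1 ?_
    filter_upwards [ae_restrict_mem measurableSet_Ioc] with t ht using hB t ht.1
  · refine Integrable.bdd_mul (c := 1) (hg.mono_set (Ioi_subset_Ioi zero_le_one))
      (by fun_prop : Measurable fun t : ℝ => t ^ (a - 1)).aestronglyMeasurable ?_
    filter_upwards [ae_restrict_mem measurableSet_Ioi] with t (ht : 1 < t)
    rw [Real.norm_of_nonneg (by positivity)]
    exact Real.rpow_le_one_of_one_le_of_nonpos ht.le (by linarith)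

theorem integrableOn_rpow_mul_exp_mul_comp_sub {u : ℝ → ℝ} (hu : Integrable u) {B : ℝ}
    (hB : ∀ x, |u x| ≤ B) {a lam : ℝ} (ha₀ : 0 < a) (ha₁ : a ≤ 1) (hlam : 0 ≤ lam) (x : ℝ) :
    IntegrableOn (fun t => t ^ (a - 1) * (Real.exp (lam * (x - t)) * u (x - t))) (Ioi 0) := by
  have hexp (t : ℝ) (ht : 0 < t) : Real.exp (lam * (x - t)) ≤ Real.exp (lam * x) :=
    Real.exp_le_exp.2 (by nlinarith)
  refine integrableOn_rpow_sub_one_mul (B := Real.exp (lam * x) * B) ha₀ ha₁ ?_ fun t ht => ?_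
  · refine (hu.comp_sub_left x).integrableOn.bdd_mul (c := Real.exp (lam * x)) (by fun_prop) ?_
    filter_upwards [ae_restrict_mem measurableSet_Ioi] with t ht
    rw [Real.norm_of_nonneg (Real.exp_pos _).le]
    exact hexp t ht
  · rw [abs_mul, abs_of_pos (Real.exp_pos _)]
    exact mul_le_mul (hexp t ht) (hB _) (abs_nonneg _) (Real.exp_pos _).le

theorem integrableOn_Iio_iff_comp_sub_left (f : ℝ → ℝ) (x : ℝ) :
    IntegrableOn f (Iio x) ↔ IntegrableOn (fun t => f (x - t)) (Ioi 0) := by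
  have h := (Measure.measurePreserving_sub_left (volume : Measure ℝ) x).integrableOn_comp_preimage
    (MeasurableEquiv.subLeft x).measurableEmbedding (f := f) (s := Iio x)
  simpa [Function.comp_def] using h.symm

theorem setIntegral_Iio_eq_comp_sub_left (f : ℝ → ℝ) (x : ℝ) :
    ∫ s in Iio x, f s = ∫ t in Ioi (0 : ℝ), f (x - t) := by
  have h := (Measure.measurePreserving_sub_left (volume : Measure ℝ) x).setIntegral_preimage_emb
    (MeasurableEquiv.subLeft x).measurableEmbedding f (Iio x)
  simpa using h.symm

variable {α lam r : ℝ} {u : ℝ → ℝ} {φ : ℝ → ℂ}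

theorem abs_le_integral_norm_of_eq_fourierInv (hrep : ∀ x, (u x : ℂ) = 𝓕⁻ φ x) (x : ℝ) :
    |u x| ≤ ∫ ω, ‖φ ω‖ := by
  rw [← Real.norm_eq_abs, ← Complex.norm_real, hrep]
  exact norm_fourierInv_le_integral_norm φ x

theorem integrableOn_leftSingularIntegral (hα₀ : 0 ≤ α) (hα : ∀ k : ℕ, α ≠ k) (hlam : 0 ≤ lam)
    (hu : Integrable u) {B : ℝ} (hB : ∀ x, |u x| ≤ B) (x : ℝ) :
    IntegrableOn (fun s => (x - s) ^ ((⌈α⌉₊ : ℝ) - α - 1) * (Real.exp (lam * s) * u s))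
      (Iio x) := by
  rw [integrableOn_Iio_iff_comp_sub_left]
  simpa using integrableOn_rpow_mul_exp_mul_comp_sub hu hB (natCeil_sub_pos hα)
    (natCeil_sub_lt_one hα₀).le hlam x

theorem ofReal_leftSingularIntegral (hα₀ : 0 ≤ α) (hα : ∀ k : ℕ, α ≠ k) (hlam : 0 ≤ lam)
    (hu : Integrable u) (hφ : HasDecay r φ) (hr : 1 < r) (hrep : ∀ x, (u x : ℂ) = 𝓕⁻ φ x) (x : ℝ) :
    (leftSingularIntegral α (fun s => Real.exp (lam * s) * u s) x : ℂ)
      = Real.Gamma (⌈α⌉₊ - α) * (Complex.exp (lam * x)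
        * 𝓕⁻ (fun ω => verticalLine lam ω ^ ((α - ⌈α⌉₊ : ℝ) : ℂ) * φ ω) x) := by
  have hint : IntegrableOn
      (fun t => ((t ^ ((⌈α⌉₊ : ℝ) - α - 1) : ℝ) : ℂ) * 𝓕⁻ φ (x - t)) (Ioi 0) := by
    have h := integrableOn_rpow_mul_exp_mul_comp_sub hu (abs_le_integral_norm_of_eq_fourierInv hrep)
      (natCeil_sub_pos hα) (natCeil_sub_lt_one hα₀).le le_rfl x
    simpa [IntegrableOn, hrep] using h.ofReal (𝕜 := ℂ)
  have h := hφ.integral_rpow_mul_cexp_mul_fourierInv hr (natCeil_sub_pos hα)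
    (natCeil_sub_lt_one hα₀) hlam hint
  rw [mul_left_comm, ← neg_sub _ α, Complex.ofReal_neg, ← h, leftSingularIntegral,
    setIntegral_Iio_eq_comp_sub_left, ← integral_complex_ofReal, ← integral_const_mul]
  congr with t
  have hexp : Complex.exp (lam * (x - t)) = Complex.exp (lam * x) * Complex.exp (-lam * t) := by
    rw [← Complex.exp_add]
    ring_nf
  rw [sub_sub_cancel]
  push_cast [hrep, hexp]
  ring

theorem HasDecay.hasDerivAt_cexp_mul_fourierInv_cpow (hφ : HasDecay r φ) (hr : 1 < r) {γ : ℝ}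
    (hγ : -1 < γ) (hγr : γ + 2 < r) (lam x : ℝ) :
    HasDerivAt
      (fun x : ℝ => Complex.exp (lam * x)
        * 𝓕⁻ (fun ω => verticalLine lam ω ^ (γ : ℂ) * φ ω) x)
      (Complex.exp (lam * x)
        * 𝓕⁻ (fun ω => verticalLine lam ω ^ ((γ + 1 : ℝ) : ℂ) * φ ω) x) x := by
  have hint := hφ.integrable_verticalLine_cpow_mul hr lam (γ := γ + 1) (by linarith) (by linarith)
  simp only [← self_mul_cpow hγ, mul_assoc] at hint ⊢
  exact hasDerivAt_cexp_mul_fourierInv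
    (hφ.integrable_verticalLine_cpow_mul hr lam hγ (by linarith)) hint x

theorem contDiff_of_contDiff_ofReal_comp {v : ℝ → ℝ} {n : ℕ}
    (hv : ContDiff ℝ n fun x => (v x : ℂ)) : ContDiff ℝ n v :=
  Complex.reCLM.contDiff.comp hv

theorem contDiff_and_ofReal_iteratedDeriv_leftSingularIntegral (hα₀ : 0 ≤ α)
    (hα : ∀ k : ℕ, α ≠ k) (hlam : 0 ≤ lam) (hu : Integrable u) (hφ : HasDecay r φ) (hr : α + 1 < r)
    (hrep : ∀ x, (u x : ℂ) = 𝓕⁻ φ x) :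
    ContDiff ℝ ⌈α⌉₊ (leftSingularIntegral α fun s => Real.exp (lam * s) * u s) ∧
    ∀ x : ℝ,
      ((iteratedDeriv ⌈α⌉₊ (leftSingularIntegral α fun s => Real.exp (lam * s) * u s) x : ℝ) : ℂ)
      = Real.Gamma (⌈α⌉₊ - α) * (Complex.exp (lam * x)
        * 𝓕⁻ (fun ω => verticalLine lam ω ^ (α : ℂ) * φ ω) x) := by
  set V := leftSingularIntegral α fun s => Real.exp (lam * s) * u s
  have hr₁ : 1 < r := by linarith
  let F (k : ℕ) (x : ℝ) : ℂ := Real.Gamma (⌈α⌉₊ - α) * (Complex.exp (lam * x)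
    * 𝓕⁻ (fun ω => verticalLine lam ω ^ ((α - ⌈α⌉₊ + k : ℝ) : ℂ) * φ ω) x)
  have hF₀ : (fun x => (V x : ℂ)) = F 0 := by
    funext x
    simpa [F] using ofReal_leftSingularIntegral hα₀ hα hlam hu hφ hr₁ hrep x
  have hFn (x : ℝ) : F ⌈α⌉₊ x = Real.Gamma (⌈α⌉₊ - α) * (Complex.exp (lam * x)
      * 𝓕⁻ (fun ω => verticalLine lam ω ^ (α : ℂ) * φ ω) x) := by
    simp only [F, sub_add_cancel]
  have hF (k : ℕ) (hk : k < ⌈α⌉₊) (x : ℝ) : HasDerivAt (F k) (F (k + 1) x) x := by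
    have hk' : (k : ℝ) + 1 ≤ ⌈α⌉₊ := mod_cast hk
    have hγ : -1 < α - ⌈α⌉₊ + k := by linarith [natCeil_sub_lt_one hα₀, k.cast_nonneg (α := ℝ)]
    have h := hφ.hasDerivAt_cexp_mul_fourierInv_cpow hr₁ hγ (by linarith) lam x
    simpa only [F, Nat.cast_add_one, add_assoc] using h.const_mul _
  have hcont : Continuous (F ⌈α⌉₊) := by
    have h := continuous_fourierInv
      (hφ.integrable_verticalLine_cpow_mul hr₁ lam (γ := α) (by linarith) hr)
    rw [funext hFn]
    fun_prop
  have hV : ContDiff ℝ ⌈α⌉₊ V :=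
    contDiff_of_contDiff_ofReal_comp (hF₀ ▸ contDiff_of_hasDerivAt hF hcont)
  refine ⟨hV, fun x => ?_⟩
  rw [← hFn, ← iteratedDeriv_eq_of_hasDerivAt hF _ le_rfl, ← hF₀, iteratedDeriv_ofReal_comp hV]

theorem ofReal_leftTemperedDeriv (hα₀ : 0 ≤ α) (hα : ∀ k : ℕ, α ≠ k) (hlam : 0 ≤ lam)
    (hu : Integrable u) (hφ : HasDecay r φ) (hr : α + 1 < r) (hrep : ∀ x, (u x : ℂ) = 𝓕⁻ φ x)
    (x : ℝ) :
    (leftTemperedDeriv α lam u x : ℂ) = 𝓕⁻ (fun ω => verticalLine lam ω ^ (α : ℂ) * φ ω) x := by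
  have hΓ : (Real.Gamma (⌈α⌉₊ - α) : ℂ) ≠ 0 :=
    mod_cast (Real.Gamma_pos_of_pos (natCeil_sub_pos hα)).ne'
  have hderiv :=
    (contDiff_and_ofReal_iteratedDeriv_leftSingularIntegral hα₀ hα hlam hu hφ hr hrep).2 x
  rw [leftTemperedDeriv, leftRLDeriv]
  push_cast [hderiv]
  rw [one_div, inv_mul_cancel_left₀ hΓ, ← mul_assoc, ← Complex.exp_add, neg_mul, neg_add_cancel,
    Complex.exp_zero, one_mul]

end RiemannLiouville

section DifferenceOperators

open FourierTransform

/-- The tempered three-point stencil `a e^{-λh} v(x - h) + b v(x) + c e^{λh} v(x + h)`. Both sides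
of the quasi-compact scheme have this form, with `v` the fractional derivative or the unshifted
Grünwald operator. -/
noncomputable def temperedStencil (a b c lam h : ℝ) (v : ℝ → ℝ) (x : ℝ) : ℝ :=
  a * Real.exp (-lam * h) * v (x - h) + b * v x + c * Real.exp (lam * h) * v (x + h)

theorem quasiCompactOp_eq_temperedStencil (α lam h : ℝ) (v : ℝ → ℝ) (x : ℝ) :
    quasiCompactOp α lam h v x = temperedStencil (coeffM α) 1 (coeffN α) lam h v x := by
  rw [quasiCompactOp, temperedStencil, one_mul]

theorem threePointSymbol_verticalLine_mul (a b c lam h ω : ℝ) (w : ℂ) :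
    threePointSymbol a b c (verticalLine lam ω * h) * w
      = a * (Complex.exp (verticalLine lam ω * (-h : ℝ)) * w) + b * w
        + c * (Complex.exp (verticalLine lam ω * h) * w) := by
  rw [threePointSymbol, Complex.ofReal_neg, mul_neg]
  ring

section Stencil

variable {g : ℝ → ℂ} (a b c lam h : ℝ)

theorem integrable_threePointSymbol_mul (hg : Integrable g) :
    Integrable fun ω => threePointSymbol a b c (verticalLine lam ω * h) * g ω := by
  simp only [threePointSymbol_verticalLine_mul]
  exact (((integrable_cexp_verticalLine_mul hg lam (-h)).const_mul _).add (hg.const_mul _)).add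
    ((integrable_cexp_verticalLine_mul hg lam h).const_mul _)

theorem ofReal_temperedStencil {v : ℝ → ℝ} (hg : Integrable g) (hv : ∀ x, (v x : ℂ) = 𝓕⁻ g x)
    (x : ℝ) : (temperedStencil a b c lam h v x : ℂ)
      = 𝓕⁻ (fun ω => threePointSymbol a b c (verticalLine lam ω * h) * g ω) x := by
  have hshift (y : ℝ) := integrable_cexp_verticalLine_mul hg lam y
  have hleft := cexp_mul_fourierInv_add lam g x (-h)
  have hright := cexp_mul_fourierInv_add lam g x h
  have hsum : Integrable fun ω =>
      a * (Complex.exp (verticalLine lam ω * (-h : ℝ)) * g ω) + b * g ω :=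
    ((hshift _).const_mul _).add (hg.const_mul _)
  simp only [threePointSymbol_verticalLine_mul]
  rw [fourierInv_add hsum ((hshift _).const_mul _),
    fourierInv_add ((hshift _).const_mul _) (hg.const_mul _), fourierInv_const_mul,
    fourierInv_const_mul, fourierInv_const_mul, ← hleft, ← hright, ← sub_eq_add_neg,
    temperedStencil]
  push_cast [hv, mul_neg, ← neg_mul]
  ring

end Stencil

theorem temperedGrunwaldTerm_eq_exp_mul (α lam : ℝ) (p : ℤ) (h : ℝ) (u : ℝ → ℝ) (x : ℝ) :
    temperedGrunwaldTerm α lam p h u x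
      = fun k => Real.exp (lam * (p * h)) * temperedGrunwaldTerm α lam 0 h u (x + p * h) k := by
  funext k
  have hexp : Real.exp (-((k : ℝ) - p) * lam * h)
      = Real.exp (lam * (p * h)) * Real.exp (-(k : ℝ) * lam * h) := by
    rw [← Real.exp_add]
    ring_nf
  rw [temperedGrunwaldTerm, hexp, temperedGrunwaldTerm, Int.cast_zero, sub_zero]
  ring_nf

theorem temperedGrunwald_eq_exp_mul (α lam : ℝ) (p : ℤ) (h : ℝ) (u : ℝ → ℝ) (x : ℝ) :
    temperedGrunwald α lam p h u x
      = Real.exp (lam * (p * h)) * temperedGrunwald α lam 0 h u (x + p * h) := by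
  rw [temperedGrunwald, temperedGrunwaldTerm_eq_exp_mul, tsum_mul_left, mul_left_comm,
    temperedGrunwald]

theorem temperedStencil_temperedGrunwald (a b c α lam h : ℝ) (u : ℝ → ℝ) (x : ℝ) :
    temperedStencil a b c lam h (temperedGrunwald α lam 0 h u) x
      = c * temperedGrunwald α lam 1 h u x + b * temperedGrunwald α lam 0 h u x
        + a * temperedGrunwald α lam (-1) h u x := by
  rw [temperedGrunwald_eq_exp_mul α lam 1, temperedGrunwald_eq_exp_mul α lam (-1), temperedStencil]
  push_cast
  ring_nf

theorem hasSum_fourierInv_pow_mul {c : ℕ → ℂ} (hc : Summable fun k => ‖c k‖) {w φ : ℝ → ℂ}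
    (hw : AEStronglyMeasurable w) (hw₁ : ∀ ω, ‖w ω‖ ≤ 1) (hφ : Integrable φ) (x : ℝ) :
    HasSum (fun k => c k * 𝓕⁻ (fun ω => w ω ^ k * φ ω) x)
      (𝓕⁻ (fun ω => (∑' k, c k * w ω ^ k) * φ ω) x) := by
  have hpow (k : ℕ) (ω : ℝ) : ‖w ω ^ k‖ ≤ 1 := by
    rw [norm_pow]
    exact pow_le_one₀ (norm_nonneg _) (hw₁ ω)
  have hterm (k : ℕ) : Integrable fun ω => c k * (Complex.exp (verticalLine 0 ω * x)
      * (w ω ^ k * φ ω)) :=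
    (integrable_cexp_verticalLine_mul (hφ.bdd_mul (hw.pow k) (.of_forall (hpow k))) 0 x).const_mul _
  have hnorm (k : ℕ) : ∫ ω, ‖c k * (Complex.exp (verticalLine 0 ω * x) * (w ω ^ k * φ ω))‖
      ≤ ‖c k‖ * ∫ ω, ‖φ ω‖ := by
    rw [← integral_const_mul]
    refine integral_mono (hterm k).norm (hφ.norm.const_mul _) fun ω => ?_
    simp only [norm_mul, norm_cexp_verticalLine_mul, zero_mul, Real.exp_zero, one_mul]
    gcongr
    exact mul_le_of_le_one_left (norm_nonneg _) (hpow k ω)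
  have hsum := hasSum_integral_of_summable_integral_norm hterm (.of_nonneg_of_le
    (fun k => integral_nonneg fun ω => norm_nonneg _) hnorm (hc.mul_right _))
  simp only [fourierInv_eq_integral_verticalLine, ← integral_const_mul]
  convert! hsum using 4 with ω
  simp only [← tsum_mul_left, ← tsum_mul_right]
  congr! 2 with k
  ring

variable {α lam h : ℝ} {u : ℝ → ℝ} {φ : ℝ → ℂ}

theorem hasSum_ofReal_temperedGrunwaldTerm (hα₀ : 0 < α) (hα : ∀ k : ℕ, α ≠ k) (hlam : 0 ≤ lam)
    (hh : 0 ≤ h) (hφ : Integrable φ) (hrep : ∀ x, (u x : ℂ) = 𝓕⁻ φ x) (x : ℝ) :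
    HasSum (fun k => (temperedGrunwaldTerm α lam 0 h u x k : ℂ))
      (𝓕⁻ (fun ω => (1 - Complex.exp (-(verticalLine lam ω * h))) ^ (α : ℂ) * φ ω) x) := by
  have hw (ω : ℝ) : ‖Complex.exp (-(verticalLine lam ω * h))‖ ≤ 1 :=
    norm_exp_neg_le_one (by simpa using mul_nonneg hlam hh)
  have hsum := hasSum_fourierInv_pow_mul (c := fun k => (grunwaldWeight α k : ℂ))
    (by simpa using summable_abs_grunwaldWeight hα₀ hα)
    (by fun_prop : Continuous fun ω => Complex.exp (-(verticalLine lam ω * h))).aestronglyMeasurable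
    hw hφ x
  simp only [tsum_grunwaldWeight_mul_pow hα₀ hα (hw _)] at hsum
  convert! hsum using 2 with k
  have hshift := cexp_mul_fourierInv_add lam φ x (-(k * h))
  simp only [temperedGrunwaldTerm, ← Complex.exp_nat_mul, Int.cast_zero, sub_zero]
  push_cast [hrep, mul_neg, mul_left_comm _ (k : ℂ)] at hshift ⊢
  rw [← hshift]
  ring_nf

theorem summable_temperedGrunwaldTerm (hα₀ : 0 < α) (hα : ∀ k : ℕ, α ≠ k) (hlam : 0 ≤ lam)
    (hh : 0 ≤ h) (hφ : Integrable φ) (hrep : ∀ x, (u x : ℂ) = 𝓕⁻ φ x) (p : ℤ) (x : ℝ) :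
    Summable (temperedGrunwaldTerm α lam p h u x) := by
  rw [temperedGrunwaldTerm_eq_exp_mul]
  exact (Complex.summable_ofReal.1
    (hasSum_ofReal_temperedGrunwaldTerm hα₀ hα hlam hh hφ hrep _).summable).mul_left _

theorem ofReal_temperedGrunwald (hα₀ : 0 < α) (hα : ∀ k : ℕ, α ≠ k) (hlam : 0 ≤ lam)
    (hh : 0 ≤ h) (hφ : Integrable φ) (hrep : ∀ x, (u x : ℂ) = 𝓕⁻ φ x) (x : ℝ) :
    (temperedGrunwald α lam 0 h u x : ℂ) = 𝓕⁻ (fun ω => ((1 / h ^ α : ℝ) : ℂ)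
      * ((1 - Complex.exp (-(verticalLine lam ω * h))) ^ (α : ℂ) * φ ω)) x := by
  rw [fourierInv_const_mul,
    ← (hasSum_ofReal_temperedGrunwaldTerm hα₀ hα hlam hh hφ hrep x).tsum_eq,
    ← Complex.ofReal_tsum, ← Complex.ofReal_mul, temperedGrunwald]

end DifferenceOperators

section Consistency

open FourierTransform

theorem symbolDefect_verticalLine_mul {α lam h : ℝ} (hα : α ≠ 0) (hlam : 0 ≤ lam) (hh : 0 < h)
    (Q S : ℂ → ℂ) (ω : ℝ) :
    symbolDefect α Q S (verticalLine lam ω * h)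
      = (h ^ α : ℝ) * (Q (verticalLine lam ω * h) * verticalLine lam ω ^ (α : ℂ))
        - S (verticalLine lam ω * h) * (1 - Complex.exp (-(verticalLine lam ω * h))) ^ (α : ℂ) := by
  have hpow : (verticalLine lam ω * h : ℂ) ^ (α : ℂ)
      = verticalLine lam ω ^ (α : ℂ) * (h ^ α : ℝ) := by
    rcases eq_or_ne (verticalLine lam ω) 0 with hzero | hne
    · simp [hzero, hα]
    · rw [mul_cpow_of_re hne (by simpa) (by simpa), Complex.ofReal_cpow hh.le]
  rw [symbolDefect, hpow]
  ring

variable {α lam h r : ℝ} {u : ℝ → ℝ} {φ : ℝ → ℂ}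

theorem integrable_one_sub_cexp_neg_cpow_mul (hα : 0 ≤ α) (hlam : 0 ≤ lam) (hh : 0 ≤ h)
    (hφ : Integrable φ) :
    Integrable fun ω => (1 - Complex.exp (-(verticalLine lam ω * h))) ^ (α : ℂ) * φ ω := by
  have hmeas : Measurable fun ω => (1 - Complex.exp (-(verticalLine lam ω * h))) ^ (α : ℂ) := by
    fun_prop
  refine hφ.bdd_mul (c := 2 ^ α) hmeas.aestronglyMeasurable (.of_forall fun ω => ?_)
  rw [Complex.norm_cpow_real]
  gcongr
  have hexp : ‖Complex.exp (-(verticalLine lam ω * h))‖ ≤ 1 :=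
    norm_exp_neg_le_one (by simpa using mul_nonneg hlam hh)
  linarith [norm_sub_le 1 (Complex.exp (-(verticalLine lam ω * h))), norm_one (α := ℂ)]

theorem ofReal_temperedStencil_sub_temperedStencil (hα₀ : 0 < α) (hα : ∀ k : ℕ, α ≠ k)
    (hlam : 0 ≤ lam) (hh : 0 < h) (hu : Integrable u) (hφ : HasDecay r φ) (hr : α + 1 < r)
    (hrep : ∀ x, (u x : ℂ) = 𝓕⁻ φ x) (a b c a' b' c' x : ℝ) :
    (temperedStencil a b c lam h (leftTemperedDeriv α lam u) x
        - temperedStencil a' b' c' lam h (temperedGrunwald α lam 0 h u) x : ℂ)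
      = 𝓕⁻ (fun ω => ((1 / h ^ α : ℝ) : ℂ)
        * (symbolDefect α (threePointSymbol a b c) (threePointSymbol a' b' c')
          (verticalLine lam ω * h) * φ ω)) x := by
  have hφi := hφ.integrable (by linarith)
  have hderiv : Integrable fun ω => verticalLine lam ω ^ (α : ℂ) * φ ω :=
    hφ.integrable_verticalLine_cpow_mul (by linarith) lam (by linarith) hr
  have hgrunwald := (integrable_one_sub_cexp_neg_cpow_mul hα₀.le hlam hh.le hφi).const_mul
    ((1 / h ^ α : ℝ) : ℂ)
  rw [ofReal_temperedStencil _ _ _ _ _ hderiv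
      (ofReal_leftTemperedDeriv hα₀.le hα hlam hu hφ hr hrep),
    ofReal_temperedStencil _ _ _ _ _ hgrunwald (ofReal_temperedGrunwald hα₀ hα hlam hh.le hφi hrep),
    ← fourierInv_sub (integrable_threePointSymbol_mul _ _ _ _ _ hderiv)
      (integrable_threePointSymbol_mul _ _ _ _ _ hgrunwald)]
  refine congrArg (fun f : ℝ → ℂ => 𝓕⁻ f x) (funext fun ω => ?_)
  have hne : ((h ^ α : ℝ) : ℂ) ≠ 0 := by exact_mod_cast (Real.rpow_pos_of_pos hh α).ne'
  rw [symbolDefect_verticalLine_mul hα₀.ne' hlam hh, Complex.ofReal_div, Complex.ofReal_one]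
  field_simp

theorem IsConsistent.exists_abs_temperedStencil_sub_le {n : ℕ} {a b c a' b' c' : ℝ}
    (hQS : IsConsistent n α (threePointSymbol a b c) (threePointSymbol a' b' c'))
    (hα₀ : 0 < α) (hα : ∀ k : ℕ, α ≠ k) (hlam : 0 ≤ lam) (hu : Integrable u) (hφ : HasDecay r φ)
    (hr : n + α + 1 < r) (hrep : ∀ x, (u x : ℂ) = 𝓕⁻ φ x) :
    ∃ C : ℝ, ∀ h : ℝ, 0 < h → h ≤ 1 → ∀ x : ℝ,
      |temperedStencil a b c lam h (leftTemperedDeriv α lam u) x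
        - temperedStencil a' b' c' lam h (temperedGrunwald α lam 0 h u) x| ≤ C * h ^ n := by
  have : (0 : ℝ) ≤ n := n.cast_nonneg
  obtain ⟨C, hC⟩ := hQS.exists_norm_symbolDefect_le hα₀ (s := {z | 0 ≤ z.re ∧ z.re ≤ lam})
    (fun z hz => hz.1) (fun z hz => norm_threePointSymbol_le a b c hz.1 hz.2)
    (fun z hz => norm_threePointSymbol_le a' b' c' hz.1 hz.2)
  have hmoment := hφ.integrable_norm_verticalLine_rpow_mul (by linarith) lam (γ := n + α)
    (by linarith) hr
  refine ⟨C * ∫ ω, ‖verticalLine lam ω‖ ^ (n + α) * ‖φ ω‖, fun h hh hh₁ x => ?_⟩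
  have hdefect (ω : ℝ) : ‖symbolDefect α (threePointSymbol a b c) (threePointSymbol a' b' c')
      (verticalLine lam ω * h)‖ ≤ C * (‖verticalLine lam ω‖ ^ (n + α) * (h ^ n * h ^ α)) := by
    refine (hC _ ⟨by simpa using mul_nonneg hlam hh.le,
      by simpa using mul_le_of_le_one_right hlam hh₁⟩).trans_eq ?_
    rw [norm_mul, Complex.norm_real, Real.norm_of_nonneg hh.le,
      Real.mul_rpow (norm_nonneg _) hh.le, Real.rpow_add hh, Real.rpow_natCast]
  rw [← Real.norm_eq_abs, ← Complex.norm_real, Complex.ofReal_sub,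
    ofReal_temperedStencil_sub_temperedStencil hα₀ hα hlam hh hu hφ (by linarith) hrep]
  refine (norm_fourierInv_le_integral_norm _ _).trans ?_
  rw [mul_right_comm, ← integral_const_mul]
  refine integral_mono_of_nonneg (.of_forall fun ω => norm_nonneg _) (hmoment.const_mul _)
    (.of_forall fun ω => ?_)
  simp only [norm_mul, Complex.norm_real]
  rw [Real.norm_of_nonneg (by positivity)]
  calc 1 / h ^ α * (‖symbolDefect α (threePointSymbol a b c) (threePointSymbol a' b' c')
          (verticalLine lam ω * h)‖ * ‖φ ω‖)
      ≤ 1 / h ^ α * (C * (‖verticalLine lam ω‖ ^ (n + α) * (h ^ n * h ^ α)) * ‖φ ω‖) := by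
        gcongr
        exact hdefect ω
    _ = C * h ^ n * (‖verticalLine lam ω‖ ^ (n + α) * ‖φ ω‖) := by
        field_simp

end Consistency

open FourierTransform in
theorem mainTheorem9_general (α lam : ℝ) (hα₀ : 0 < α) (hα : ∀ k : ℕ, α ≠ k) (hlam : 0 ≤ lam)
    (hden : coeffDen α ≠ 0) (N : ℕ) (hN : α + 6 < N) (u : ℝ → ℝ) (hu : ContDiff ℝ N u)
    (hL1 : ∀ k ≤ N, Integrable (iteratedDeriv k u)) :
    (∀ x : ℝ, IntegrableOn
      (fun s => (x - s) ^ ((⌈α⌉₊ : ℝ) - α - 1) * (Real.exp (lam * s) * u s)) (Iio x)) ∧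
    ContDiff ℝ ⌈α⌉₊ (leftSingularIntegral α (fun s => Real.exp (lam * s) * u s)) ∧
    (∀ p : ℤ, ∀ h : ℝ, 0 < h → ∀ x : ℝ, Summable (temperedGrunwaldTerm α lam p h u x)) ∧
    (∃ C : ℝ, ∃ h₀ : ℝ, 0 < h₀ ∧ ∀ h : ℝ, 0 < h → h ≤ h₀ → ∀ x : ℝ,
      |quasiCompactOp α lam h (leftTemperedDeriv α lam u) x
        - (coeffMuOne α * temperedGrunwald α lam 1 h u x
          + coeffMuZero α * temperedGrunwald α lam 0 h u x
          + coeffMuNegOne α * temperedGrunwald α lam (-1) h u x)| ≤ C * h ^ 5) := by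
  have hui : Integrable u := by simpa using hL1 0 N.zero_le
  have hderiv (k : ℕ) (hk : k ≤ N) : Integrable (iteratedDeriv k fun x => (u x : ℂ)) := by
    rw [iteratedDeriv_ofReal_comp (hu.of_le (mod_cast hk))]
    exact (hL1 k hk).ofReal
  have hφ : HasDecay N (𝓕 fun x => (u x : ℂ)) :=
    hasDecay_fourier (Complex.ofRealCLM.contDiff.comp hu) hderiv
  have hφi : Integrable (𝓕 fun x => (u x : ℂ)) := hφ.integrable (by linarith)
  have hrep (x : ℝ) : (u x : ℂ) = 𝓕⁻ (𝓕 fun x => (u x : ℂ)) x :=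
    (congrFun ((Complex.continuous_ofReal.comp hu.continuous).fourierInv_fourier_eq hui.ofReal
      hφi) x).symm
  obtain ⟨C, hC⟩ := (isConsistent_quasiCompact hden).exists_abs_temperedStencil_sub_le hα₀ hα hlam
    hui hφ (by push_cast; linarith) hrep
  simp only [← quasiCompactOp_eq_temperedStencil, temperedStencil_temperedGrunwald] at hC
  exact ⟨integrableOn_leftSingularIntegral hα₀.le hα hlam hui
      (abs_le_integral_norm_of_eq_fourierInv hrep),
    (contDiff_and_ofReal_iteratedDeriv_leftSingularIntegral hα₀.le hα hlam hui hφ (by linarith)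
      hrep).1,
    fun p h hh => summable_temperedGrunwaldTerm hα₀ hα hlam hh.le hφi hrep p, C, 1, one_pos, hC⟩

theorem mainTheorem9 (α lam : ℝ) (hα₁ : 1 < α) (hα₂ : α < 2) (hlam : 0 ≤ lam)
    (hden : coeffDen α ≠ 0)
    (u : ℝ → ℝ) (hu : ContDiff ℝ 8 u)
    (hL1 : ∀ k : ℕ, k ≤ 8 → Integrable (iteratedDeriv k u) volume) :
    -- the tempered derivative is well defined: the integral converges and is twice differentiable
    (∀ x : ℝ, IntegrableOn
      (fun s => (x - s) ^ ((⌈α⌉₊ : ℝ) - α - 1) * (Real.exp (lam * s) * u s)) (Iio x) volume) ∧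
    ContDiff ℝ 2 (leftSingularIntegral α (fun s => Real.exp (lam * s) * u s)) ∧
    -- the series defining the difference operators converge
    (∀ p : ℤ, ∀ h : ℝ, 0 < h → ∀ x : ℝ, Summable (temperedGrunwaldTerm α lam p h u x)) ∧
    -- fifth order accuracy, uniformly in `x`
    (∃ C : ℝ, ∃ h₀ : ℝ, 0 < h₀ ∧ ∀ h : ℝ, 0 < h → h ≤ h₀ → ∀ x : ℝ,
      |quasiCompactOp α lam h (leftTemperedDeriv α lam u) x
        - (coeffMuOne α * temperedGrunwald α lam 1 h u x
          + coeffMuZero α * temperedGrunwald α lam 0 h u x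
          + coeffMuNegOne α * temperedGrunwald α lam (-1) h u x)| ≤ C * h ^ 5) := by
  have hceil : ⌈α⌉₊ = 2 := (Nat.ceil_eq_iff two_ne_zero).2 ⟨by norm_num [hα₁], mod_cast hα₂.le⟩
  have hα (k : ℕ) : α ≠ k := by rintro rfl; norm_cast at hα₁ hα₂; omega
  simpa [hceil] using mainTheorem9_general α lam (by linarith) hα hlam hden 8
    (by norm_num; linarith) u (mod_cast hu) hL1
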